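/- Let $\mathfrak g$ be a finite-dimensional real Lie algebra with a symplectic form $\omega$ (a non-degenerate closed 2-form for the Chevalley–Eilenberg differential) and a non-degenerate symmetric bilinear form $g$, and let $V$ be the underlying vector space of $\mathfrak g$. Let $\gamma:\mathfrak g\to \mathrm{End}(V)$ be a torsion-free flat symplectic connection: $\gamma(x)y-\gamma(y)x=[x,y]$, $\gamma([x,y])=\gamma(x)\gamma(y)-\gamma(y)\gamma(x)$ and $\omega(\gamma(x)y,z)+\omega(y,\gamma(x)z)=0$. Let $\mathfrak h=\mathfrak g\ltimes_\gamma V$, with bracket $[(x,u),(y,v)]=([x,y],\gamma(x)v-\gamma(y)u)$, and put $$J(x,u)=(-u,x),\qquad \Delta((x,u),(y,v))=g(x,y)+g(u,v),$$ $$\Omega_1((x,u),(y,v))=-\omega(x,v)-\omega(u,y),\quad \Omega_2((x,u),(y,v))=\omega(x,y)-\omega(u,v),\quad \Omega_3((x,u),(y,v))=\omega(x,y)+\omega(u,v).$$ Then $J$ is an integrable complex structure on $\mathfrak h$, $\Omega_1,\Omega_2,\Omega_3$ are symplectic forms on $\mathfrak h$, and $\Delta$ is a non-degenerate symmetric bilinear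 form. An (invariant) generalized complex structure on $\mathfrak h$ is given by a maximal isotropic subspace $L$ of $(\mathfrak h\oplus\mathfrak h^*)_{\mathbb C}$, with respect to $\langle X+\alpha,Y+\beta\rangle=\frac12(\alpha(Y)+\beta(X))$, that is closed under the Courant bracket $[\![X+\alpha,Y+\beta]\!]=[X,Y]+\mathcal L_X\beta-\mathcal L_Y\alpha$ and satisfies $L\cap\overline L=0$. The complex structure $J$ gives $L_J=\mathfrak h^{1,0}\oplus\mathfrak h^{*(0,1)}$, and a symplectic form $\Omega$ gives $L_\Omega=\{X-i\iota_X\Omega: X\in\mathfrak h_{\mathbb C}\}$. The differential Gerstenhaber algebra of $L$ is $(\wedge^\bullet L,[\![-,-]\!],\wedge,\overline\partial)$, where $[\![-,-]\!]$ is the Schouten bracket extending the Courant bracket of $L$ and $\overline\partial$ is the Chevalley–Eilenberg differential of the Lie algebra $\overline L$, with $\overline L^*$ identified with $L$ through $2\langle-,-\rangle$. We write $\mathrm{DGA}(J)$ and $\mathrm{DGA}(\Omega_2)$ for those of $L_J$ and $L_{\Omega_2}$. For $\Gamma\in\wedge^2L$, viewed by contraction as a map $\overline L\to L$, let $\overline\Gamma:L\to\overline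 L$ be its conjugate; the deformation of $L$ along $\Gamma$ is $L_{\overline\Gamma}=\{\ell+\overline\Gamma(\ell):\ell\in L\}$. Suppose that $(J,\Delta)$ is pseudo-Kähler, i.e. $\Delta$ is $J$-invariant and the 2-form $\Delta(J-,-)$ is closed, and that $$(g^{-1}\omega)(\gamma(a)b)=\gamma((g^{-1}\omega)a)\,((g^{-1}\omega)b)\qquad\text{for all }a,b\in\mathfrak g,$$ where $g^{-1}\omega:V\to V$ is the map with $g((g^{-1}\omega)a,b)=\omega(a,b)$. Then there is a deformation from $J$ to the symplectic structure $\Omega_2$, up to the $B$-field transformation by the closed form $\Omega_1$: there is $\Lambda\in\wedge^2L_J$ such that $(L_J)_{t\overline\Lambda}$ is a generalized complex structure for all $t\in\mathbb R$ (equal to $L_J$ for $t=0$), and $$(L_J)_{\overline\Lambda}=\{X+\alpha+\iota_X\Omega_1: X+\alpha\in L_{\Omega_2}\}.$$ Moreover $\mathrm{DGA}(J)$ and $\mathrm{DGA}(\Omega_2)$ are isomorphic as differential Gerstenhaber algebras, by a degree-preserving isomorphism of exterior algebras respecting brackets and differentials. -/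

import Mathlib

open scoped TensorProduct

namespace GenGeom

noncomputable section

/-! ## Complexified generalized tangent space of a real Lie algebra

Invariant objects on a Lie group are identified with linear objects on its Lie algebra `𝔥`. -/

/-- The complexified generalized tangent space `(𝔥 ⊕ 𝔥^*)_ℂ = 𝔥_ℂ ⊕ (𝔥_ℂ)^*`. -/
abbrev GenTangent (𝔥 : Type*) [LieRing 𝔥] [LieAlgebra ℝ 𝔥] : Type _ :=
  (ℂ ⊗[ℝ] 𝔥) × Module.Dual ℂ (ℂ ⊗[ℝ] 𝔥)

section Basic

variable {𝔥 : Type*} [LieRing 𝔥] [LieAlgebra ℝ 𝔥]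

theorem cx_lie_add (X Y Z : ℂ ⊗[ℝ] 𝔥) : ⁅X, Y + Z⁆ = ⁅X, Y⁆ + ⁅X, Z⁆ := lie_add X Y Z

theorem cx_add_lie (X Y Z : ℂ ⊗[ℝ] 𝔥) : ⁅X + Y, Z⁆ = ⁅X, Z⁆ + ⁅Y, Z⁆ := add_lie X Y Z

theorem cx_lie_zero (X : ℂ ⊗[ℝ] 𝔥) : ⁅X, (0 : ℂ ⊗[ℝ] 𝔥)⁆ = 0 := lie_zero X

theorem cx_zero_lie (X : ℂ ⊗[ℝ] 𝔥) : ⁅(0 : ℂ ⊗[ℝ] 𝔥), X⁆ = 0 := zero_lie X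

theorem cx_lie_smul (c : ℂ) (X Y : ℂ ⊗[ℝ] 𝔥) : ⁅X, c • Y⁆ = c • ⁅X, Y⁆ := lie_smul c X Y

theorem cx_smul_lie (c : ℂ) (X Y : ℂ ⊗[ℝ] 𝔥) : ⁅c • X, Y⁆ = c • ⁅X, Y⁆ := smul_lie c X Y

theorem cx_lie_skew (X Y : ℂ ⊗[ℝ] 𝔥) : ⁅X, Y⁆ = -⁅Y, X⁆ := (lie_skew X Y).symm

/-- The natural symmetric pairing `⟨X + α, Y + β⟩ = (α(Y) + β(X)) / 2`. -/
def pairing (a b : GenTangent 𝔥) : ℂ := (1 / 2 : ℂ) * (a.2 b.1 + b.2 a.1)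

/-- The identification of the generalized tangent space with its dual,
`σ(a)(b) = 2 ⟨a, b⟩`. -/
def sigma : GenTangent 𝔥 →ₗ[ℂ] Module.Dual ℂ (GenTangent 𝔥) where
  toFun a :=
    { toFun := fun b => a.2 b.1 + b.2 a.1
      map_add' := fun b c => by simp; ring
      map_smul' := fun r b => by simp; ring }
  map_add' a b := by ext <;> simp
  map_smul' r a := by ext <;> simp

theorem sigma_apply (a b : GenTangent 𝔥) : sigma a b = a.2 b.1 + b.2 a.1 := rfl

theorem sigma_eq_two_pairing (a b : GenTangent 𝔥) : sigma a b = 2 * pairing a b := by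
  simp only [sigma_apply, pairing]; ring

/-- The Lie derivative of an invariant 1-form: `(ℒ_X β)(Y) = -β([X, Y])`. -/
def lieDer (X : ℂ ⊗[ℝ] 𝔥) (β : Module.Dual ℂ (ℂ ⊗[ℝ] 𝔥)) : Module.Dual ℂ (ℂ ⊗[ℝ] 𝔥) :=
  -(β ∘ₗ (LieAlgebra.ad ℂ (ℂ ⊗[ℝ] 𝔥) X : (ℂ ⊗[ℝ] 𝔥) →ₗ[ℂ] (ℂ ⊗[ℝ] 𝔥)))

theorem lieDer_apply (X Y : ℂ ⊗[ℝ] 𝔥) (β : Module.Dual ℂ (ℂ ⊗[ℝ] 𝔥)) :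
    lieDer X β Y = -β ⁅X, Y⁆ := rfl

/-- The Courant bracket of invariant sections,
`⟦X + α, Y + β⟧ = [X, Y] + ℒ_X β - ℒ_Y α`. The remaining term
`-(1/2) d (ι_X β - ι_Y α)` of the Courant bracket vanishes, since it is the differential of a
constant function. -/
def courant (a b : GenTangent 𝔥) : GenTangent 𝔥 :=
  (⁅a.1, b.1⁆, lieDer a.1 b.2 - lieDer b.1 a.2)

/-- Complex conjugation on `𝔥_ℂ`. -/
def conjV : (ℂ ⊗[ℝ] 𝔥) →ₛₗ[starRingEnd ℂ] (ℂ ⊗[ℝ] 𝔥) where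
  toFun := TensorProduct.map (Complex.conjAe.toLinearEquiv : ℂ →ₗ[ℝ] ℂ) (LinearMap.id : 𝔥 →ₗ[ℝ] 𝔥)
  map_add' := map_add _
  map_smul' r x := by
    induction x with
    | zero => simp
    | tmul z v => simp [TensorProduct.smul_tmul']
    | add x y hx hy => simp [hx, hy]

@[simp] theorem conjV_tmul (z : ℂ) (v : 𝔥) :
    conjV (z ⊗ₜ[ℝ] v) = (starRingEnd ℂ z) ⊗ₜ[ℝ] v := rfl

@[simp] theorem conjV_conjV (x : ℂ ⊗[ℝ] 𝔥) : conjV (conjV x) = x := by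
  induction x with
  | zero => simp
  | tmul z v => simp
  | add x y hx hy => simp [hx, hy]

/-- Complex conjugation on `(𝔥_ℂ)^*`: the conjugate of `α` is the form sending `X` to the
conjugate of `α (conj X)`. -/
def conjD : Module.Dual ℂ (ℂ ⊗[ℝ] 𝔥) →ₛₗ[starRingEnd ℂ] Module.Dual ℂ (ℂ ⊗[ℝ] 𝔥) where
  toFun α :=
    { toFun := fun X => starRingEnd ℂ (α (conjV X))
      map_add' := fun X Y => by simp
      map_smul' := fun r X => by simp }
  map_add' α β := by ext; simp
  map_smul' r α := by ext; simp

theorem conjD_apply (α : Module.Dual ℂ (ℂ ⊗[ℝ] 𝔥)) (X : ℂ ⊗[ℝ] 𝔥) :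
    conjD α X = starRingEnd ℂ (α (conjV X)) := rfl

/-- Complex conjugation on the complexified generalized tangent space. -/
def conjE : GenTangent 𝔥 →ₛₗ[starRingEnd ℂ] GenTangent 𝔥 where
  toFun a := (conjV a.1, conjD a.2)
  map_add' a b := by simp
  map_smul' r a := by simp

theorem conjE_apply (a : GenTangent 𝔥) : conjE a = (conjV a.1, conjD a.2) := rfl

/-- The conjugate of a complex subspace (conjugation is an involution, so preimage and image
agree). -/
def conjSub (L : Submodule ℂ (GenTangent 𝔥)) : Submodule ℂ (GenTangent 𝔥) := L.comap conjE

theorem mem_conjSub {L : Submodule ℂ (GenTangent 𝔥)} {a : GenTangent 𝔥} :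
    a ∈ conjSub L ↔ conjE a ∈ L := Iff.rfl

end Basic

/-! ## Generalized complex structures -/

/-- An invariant generalized complex structure on `𝔥`, given by its `+i`-eigenspace `L`: a maximal
isotropic subspace with `L ∩ conj L = 0`, closed under the Courant bracket. Maximal isotropy and
transversality are recorded together as: `L` is isotropic and `L ⊕ conj L` is everything. -/
structure GenComplex (𝔥 : Type*) [LieRing 𝔥] [LieAlgebra ℝ 𝔥] where
  /-- the `+i`-eigenspace -/
  L : Submodule ℂ (GenTangent 𝔥)
  isotropic : ∀ a ∈ L, ∀ b ∈ L, pairing a b = 0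
  isCompl : IsCompl L (conjSub L)
  closed : ∀ a ∈ L, ∀ b ∈ L, courant a b ∈ L

/-- The subspace `L` is (the `+i`-eigenspace of) a generalized complex structure. -/
def IsGenComplex {𝔥 : Type*} [LieRing 𝔥] [LieAlgebra ℝ 𝔥]
    (L : Submodule ℂ (GenTangent 𝔥)) : Prop := ∃ 𝒥 : GenComplex 𝔥, 𝒥.L = L

/-- An integrable complex structure: `J² = -1` and the Nijenhuis tensor vanishes. -/
def IsComplexStructure {𝔥 : Type*} [LieRing 𝔥] [LieAlgebra ℝ 𝔥] (J : 𝔥 →ₗ[ℝ] 𝔥) : Prop :=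
  (∀ x, J (J x) = -x) ∧
    ∀ x y, ⁅J x, J y⁆ - J ⁅J x, y⁆ - J ⁅x, J y⁆ - ⁅x, y⁆ = 0

/-- A bilinear form, viewed as a 2-form, is closed for the Chevalley-Eilenberg differential. -/
def IsClosedForm {𝔥 : Type*} [LieRing 𝔥] [LieAlgebra ℝ 𝔥] (Ω : LinearMap.BilinForm ℝ 𝔥) : Prop :=
  ∀ x y z, Ω ⁅x, y⁆ z + Ω ⁅y, z⁆ x + Ω ⁅z, x⁆ y = 0

/-- A symplectic structure on a Lie algebra: a closed non-degenerate 2-form. -/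
structure IsSymplectic {𝔥 : Type*} [LieRing 𝔥] [LieAlgebra ℝ 𝔥]
    (Ω : LinearMap.BilinForm ℝ 𝔥) : Prop where
  isAlt : Ω.IsAlt
  nondegenerate : Ω.Nondegenerate
  closed : IsClosedForm Ω

/-- A pseudo-metric: a non-degenerate symmetric bilinear form. -/
structure IsPseudoMetric {V : Type*} [AddCommGroup V] [Module ℝ V]
    (g : LinearMap.BilinForm ℝ V) : Prop where
  isSymm : g.IsSymm
  nondegenerate : g.Nondegenerate

/-- `(J, Δ)` is a pseudo-Kähler structure: `J` is a complex structure, `Δ` is a `J`-invariant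
pseudo-metric, and the fundamental form `(X, Y) ↦ Δ(JX, Y)` is closed. -/
structure IsPseudoKahler {𝔥 : Type*} [LieRing 𝔥] [LieAlgebra ℝ 𝔥]
    (J : 𝔥 →ₗ[ℝ] 𝔥) (Δ : LinearMap.BilinForm ℝ 𝔥) : Prop where
  isComplex : IsComplexStructure J
  isPseudoMetric : IsPseudoMetric Δ
  invariant : ∀ x y, Δ (J x) (J y) = Δ x y
  closed : IsClosedForm (Δ ∘ₗ J)

section Examples

variable {𝔥 : Type*} [LieRing 𝔥] [LieAlgebra ℝ 𝔥]

/-- The space `𝔥^{1,0}` of `(1,0)`-vectors: the `i`-eigenspace of `J` on `𝔥_ℂ`. -/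
def T10 (J : 𝔥 →ₗ[ℝ] 𝔥) : Submodule ℂ (ℂ ⊗[ℝ] 𝔥) :=
  LinearMap.ker (J.baseChange ℂ - Complex.I • LinearMap.id)

theorem mem_T10 {J : 𝔥 →ₗ[ℝ] 𝔥} {X : ℂ ⊗[ℝ] 𝔥} :
    X ∈ T10 J ↔ J.baseChange ℂ X = Complex.I • X := by
  simp [T10, sub_eq_zero]

theorem baseChange_conjV (J : 𝔥 →ₗ[ℝ] 𝔥) (X : ℂ ⊗[ℝ] 𝔥) :
    J.baseChange ℂ (conjV X) = conjV (J.baseChange ℂ X) := by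
  induction X with
  | zero => simp
  | tmul z v => simp
  | add x y hx hy => simp [hx, hy]

theorem baseChange_sq {J : 𝔥 →ₗ[ℝ] 𝔥} (hJ : ∀ x, J (J x) = -x) (X : ℂ ⊗[ℝ] 𝔥) :
    J.baseChange ℂ (J.baseChange ℂ X) = -X := by
  induction X with
  | zero => simp
  | tmul z v => simp [hJ, TensorProduct.tmul_neg]
  | add x y hx hy => simp [hx, hy]; abel

theorem nijenhuis_baseChange {J : 𝔥 →ₗ[ℝ] 𝔥} (hJ : IsComplexStructure J) (X Y : ℂ ⊗[ℝ] 𝔥) :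
    ⁅J.baseChange ℂ X, J.baseChange ℂ Y⁆ - J.baseChange ℂ ⁅J.baseChange ℂ X, Y⁆
      - J.baseChange ℂ ⁅X, J.baseChange ℂ Y⁆ - ⁅X, Y⁆ = 0 := by
  induction X with
  | zero => simp
  | add x x' hx hx' =>
    simp only [map_add, cx_add_lie]
    calc _ = _ := ?_
      _ = (0 : ℂ ⊗[ℝ] 𝔥) + 0 := congrArg₂ (· + ·) hx hx'
      _ = 0 := add_zero 0
    abel
  | tmul z v =>
    induction Y with
    | zero => simp [cx_lie_zero]
    | add y y' hy hy' =>
      simp only [map_add, cx_lie_add]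
      calc _ = _ := ?_
        _ = (0 : ℂ ⊗[ℝ] 𝔥) + 0 := congrArg₂ (· + ·) hy hy'
        _ = 0 := add_zero 0
      abel
    | tmul w u =>
      simp only [LinearMap.baseChange_tmul, LieAlgebra.ExtendScalars.bracket_tmul,
        ← TensorProduct.tmul_sub, hJ.2 v u, TensorProduct.tmul_zero]

/-- The generalized complex structure of a classical complex structure,
`L = 𝔥^{1,0} ⊕ 𝔥^{*(0,1)}`, where the `(0,1)`-forms are the forms that vanish on `𝔥^{1,0}`. -/
def ofComplex (J : 𝔥 →ₗ[ℝ] 𝔥) (hJ : IsComplexStructure J) : GenComplex 𝔥 where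
  L := (T10 J).prod (T10 J).dualAnnihilator
  isotropic a ha b hb := by
    have h1 : a.2 b.1 = 0 := (Submodule.mem_dualAnnihilator _).1 ha.2 _ hb.1
    have h2 : b.2 a.1 = 0 := (Submodule.mem_dualAnnihilator _).1 hb.2 _ ha.1
    simp [pairing, h1, h2]
  isCompl := by
    set Jc := J.baseChange ℂ with hJc
    have hP : ∀ X : ℂ ⊗[ℝ] 𝔥, (1 / 2 : ℂ) • (X - Complex.I • Jc X) ∈ T10 J := by
      intro X
      rw [mem_T10, ← hJc]
      simp only [map_smul, map_sub, baseChange_sq hJ.1 X, hJc]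
      rw [smul_comm Complex.I (1 / 2 : ℂ)]
      congr 1
      rw [smul_sub, smul_smul, Complex.I_mul_I]
      simp only [smul_neg, neg_smul, one_smul]
      abel
    have hQ : ∀ X : ℂ ⊗[ℝ] 𝔥, conjV ((1 / 2 : ℂ) • (X + Complex.I • Jc X)) ∈ T10 J := by
      intro X
      have : conjV ((1 / 2 : ℂ) • (X + Complex.I • Jc X))
          = (1 / 2 : ℂ) • (conjV X - Complex.I • Jc (conjV X)) := by
        rw [hJc, baseChange_conjV]
        simp only [map_smulₛₗ, map_add, Complex.conj_I, map_div₀, map_one, map_ofNat, neg_smul,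
          sub_eq_add_neg]
      rw [this]; exact hP _
    have hPQ : ∀ X : ℂ ⊗[ℝ] 𝔥,
        X = (1 / 2 : ℂ) • (X - Complex.I • Jc X) + (1 / 2 : ℂ) • (X + Complex.I • Jc X) := by
      intro X; module
    constructor
    · rw [Submodule.disjoint_def]
      rintro ⟨X, α⟩ ⟨hX, hα⟩ ⟨hX', hα'⟩
      simp only [conjE_apply] at hX hα hX' hα'
      have hα1 := (Submodule.mem_dualAnnihilator _).1 hα
      have hα2 := (Submodule.mem_dualAnnihilator _).1 hα'
      ext1
      · have h1 := mem_T10.1 hX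
        have h2 := mem_T10.1 hX'
        rw [baseChange_conjV, h1] at h2
        have h3 := congrArg conjV h2
        simp only [map_smulₛₗ, conjV_conjV, Complex.conj_I] at h3
        have h4 : (2 * Complex.I) • X = 0 := by
          have : (2 * Complex.I) • X = Complex.I • X - (-Complex.I) • X := by module
          rw [this, ← h3]; simp
        exact (smul_eq_zero.1 h4).resolve_left (by simp)
      · show α = 0
        refine LinearMap.ext fun X => ?_
        rw [hPQ X, map_add, hα1 _ (hP X)]
        have := hα2 _ (hQ X)
        rw [conjD_apply, conjV_conjV] at this
        have h0 := congrArg (starRingEnd ℂ) this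
        simp only [RingHomCompTriple.comp_apply, RingHom.id_apply, map_zero] at h0
        rw [h0]; simp
    · rw [codisjoint_iff, eq_top_iff]
      rintro ⟨X, α⟩ -
      let P : (ℂ ⊗[ℝ] 𝔥) →ₗ[ℂ] (ℂ ⊗[ℝ] 𝔥) := (1 / 2 : ℂ) • (LinearMap.id - Complex.I • Jc)
      let Q : (ℂ ⊗[ℝ] 𝔥) →ₗ[ℂ] (ℂ ⊗[ℝ] 𝔥) := (1 / 2 : ℂ) • (LinearMap.id + Complex.I • Jc)
      refine Submodule.mem_sup.2 ⟨(P X, α ∘ₗ Q), ⟨hP X, ?_⟩, (Q X, α ∘ₗ P), ⟨hQ X, ?_⟩, ?_⟩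
      · refine (Submodule.mem_dualAnnihilator _).2 fun Y hY => ?_
        have h1 := mem_T10.1 hY
        have : Q Y = 0 := by
          simp only [Q, LinearMap.smul_apply, LinearMap.add_apply, LinearMap.id_apply, hJc, h1,
            smul_smul, Complex.I_mul_I]
          simp
        simp [this]
      · refine (Submodule.mem_dualAnnihilator _).2 fun Y hY => ?_
        have h1 := mem_T10.1 hY
        have : P (conjV Y) = 0 := by
          simp only [P, LinearMap.smul_apply, LinearMap.sub_apply, LinearMap.id_apply, hJc,
            baseChange_conjV, h1, map_smulₛₗ, Complex.conj_I, smul_smul]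
          simp
        simp [conjE_apply, conjD_apply, this]
      · ext1
        · exact (hPQ X).symm
        · refine LinearMap.ext fun Y => ?_
          show α (Q Y) + α (P Y) = α Y
          rw [← map_add, add_comm]
          exact congrArg α (hPQ Y).symm
  closed a ha b hb := by
    have cl : ∀ X ∈ T10 J, ∀ Y ∈ T10 J, ⁅X, Y⁆ ∈ T10 J := by
      intro X hX Y hY
      have h := nijenhuis_baseChange hJ X Y
      rw [mem_T10.1 hX, mem_T10.1 hY] at h
      rw [mem_T10]
      simp only [cx_smul_lie, cx_lie_smul, map_smul, smul_smul, Complex.I_mul_I] at h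
      have h2 : (2 * Complex.I) • (J.baseChange ℂ ⁅X, Y⁆ - Complex.I • ⁅X, Y⁆) = 0 := by
        rw [← neg_eq_zero, ← h, smul_sub, smul_smul, mul_assoc, Complex.I_mul_I]
        module
      exact sub_eq_zero.1 ((smul_eq_zero.1 h2).resolve_left (by simp))
    refine ⟨cl _ ha.1 _ hb.1, (Submodule.mem_dualAnnihilator _).2 fun Y hY => ?_⟩
    have h1 := (Submodule.mem_dualAnnihilator _).1 ha.2 _ (cl _ hb.1 _ hY)
    have h2 := (Submodule.mem_dualAnnihilator _).1 hb.2 _ (cl _ ha.1 _ hY)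
    simp [courant, lieDer_apply, h1, h2]

theorem baseChange_alt {Ω : LinearMap.BilinForm ℝ 𝔥} (h : Ω.IsAlt) (X Y : ℂ ⊗[ℝ] 𝔥) :
    Ω.baseChange ℂ X Y = -Ω.baseChange ℂ Y X := by
  induction X with
  | zero => simp
  | add x x' hx hx' => simp [hx, hx']; ring
  | tmul z v =>
    induction Y with
    | zero => simp
    | add y y' hy hy' => simp only [map_add, LinearMap.add_apply, hy, hy']; ring
    | tmul w u =>
      have : Ω u v = -Ω v u := (LinearMap.BilinForm.IsAlt.neg_eq h v u).symm
      simp [this, mul_comm]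

theorem baseChange_closed {Ω : LinearMap.BilinForm ℝ 𝔥} (h : IsClosedForm Ω)
    (X Y Z : ℂ ⊗[ℝ] 𝔥) :
    Ω.baseChange ℂ ⁅X, Y⁆ Z + Ω.baseChange ℂ ⁅Y, Z⁆ X + Ω.baseChange ℂ ⁅Z, X⁆ Y = 0 := by
  induction X with
  | zero => simp [cx_lie_zero]
  | add x x' hx hx' =>
    simp only [map_add, cx_add_lie, cx_lie_add, LinearMap.add_apply]
    linear_combination hx + hx'
  | tmul z v =>
    induction Y with
    | zero => simp [cx_lie_zero]
    | add y y' hy hy' =>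
      simp only [map_add, cx_add_lie, cx_lie_add, LinearMap.add_apply]
      linear_combination hy + hy'
    | tmul w u =>
      induction Z with
      | zero => simp [cx_lie_zero]
      | add y y' hy hy' =>
        simp only [map_add, cx_add_lie, cx_lie_add, LinearMap.add_apply]
        linear_combination hy + hy'
      | tmul s t =>
        have := congrArg (Complex.ofReal) (h v u t)
        simp only [LieAlgebra.ExtendScalars.bracket_tmul, LinearMap.BilinForm.baseChange_tmul,
          Complex.real_smul]
        push_cast at this
        linear_combination (z * w * s) * this

theorem baseChange_conj (Ω : LinearMap.BilinForm ℝ 𝔥) (X Y : ℂ ⊗[ℝ] 𝔥) :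
    Ω.baseChange ℂ (conjV X) (conjV Y) = starRingEnd ℂ (Ω.baseChange ℂ X Y) := by
  induction X with
  | zero => simp
  | add x x' hx hx' => simp [hx, hx']
  | tmul z v =>
    induction Y with
    | zero => simp
    | add y y' hy hy' => simp only [map_add, hy, hy']
    | tmul w u => simp

theorem exists_re_im (X : ℂ ⊗[ℝ] 𝔥) :
    ∃ x y : 𝔥, X = (1 : ℂ) ⊗ₜ[ℝ] x + Complex.I ⊗ₜ[ℝ] y := by
  induction X with
  | zero => exact ⟨0, 0, by simp⟩
  | add X Y hX hY =>
    obtain ⟨x, y, rfl⟩ := hX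
    obtain ⟨x', y', rfl⟩ := hY
    exact ⟨x + x', y + y', by simp only [TensorProduct.tmul_add]; abel⟩
  | tmul z v =>
    refine ⟨z.re • v, z.im • v, ?_⟩
    rw [← TensorProduct.smul_tmul, ← TensorProduct.smul_tmul, ← TensorProduct.add_tmul]
    congr 1
    apply Complex.ext <;> simp

theorem baseChange_injective {Ω : LinearMap.BilinForm ℝ 𝔥} (h : Ω.Nondegenerate) :
    Function.Injective (Ω.baseChange ℂ) := by
  rw [injective_iff_map_eq_zero]
  intro X hX
  obtain ⟨x, y, rfl⟩ := exists_re_im X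
  have hz : ∀ z, Ω x z = 0 ∧ Ω y z = 0 := by
    intro z
    have := LinearMap.congr_fun hX ((1 : ℂ) ⊗ₜ[ℝ] z)
    simp only [map_add, LinearMap.add_apply, LinearMap.BilinForm.baseChange_tmul,
      Complex.real_smul, LinearMap.zero_apply] at this
    have h1 := congrArg Complex.re this
    have h2 := congrArg Complex.im this
    simp at h1 h2
    exact ⟨h1, h2⟩
  have hx : x = 0 := h.1 x fun z => (hz z).1
  have hy : y = 0 := h.1 y fun z => (hz z).2
  simp [hx, hy]

/-- The generalized complex structure of a symplectic form, `L = {X - i ι_X Ω}`. -/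
def ofSymplectic [FiniteDimensional ℝ 𝔥] (Ω : LinearMap.BilinForm ℝ 𝔥) (hΩ : IsSymplectic Ω) :
    GenComplex 𝔥 where
  L := LinearMap.range
    (LinearMap.prod (LinearMap.id : (ℂ ⊗[ℝ] 𝔥) →ₗ[ℂ] (ℂ ⊗[ℝ] 𝔥))
      (-(Complex.I • Ω.baseChange ℂ)))
  isotropic := by
    rintro _ ⟨X, rfl⟩ _ ⟨Y, rfl⟩
    simp [pairing, baseChange_alt hΩ.isAlt X Y]
  isCompl := by
    have hinj := baseChange_injective hΩ.nondegenerate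
    have hsurj : Function.Surjective (Ω.baseChange ℂ) :=
      (LinearMap.injective_iff_surjective_of_finrank_eq_finrank
        (Subspace.dual_finrank_eq).symm).1 hinj
    constructor
    · rw [Submodule.disjoint_def]
      rintro _ ⟨X, rfl⟩ ⟨Y, hY⟩
      have h1 : Y = conjV X := congrArg Prod.fst hY
      have h2 := congrArg Prod.snd hY
      have hX : Ω.baseChange ℂ X = 0 := by
        refine LinearMap.ext fun Z => ?_
        have := LinearMap.congr_fun h2 (conjV Z)
        simp only [h1, LinearMap.prod_apply, Function.prod, conjE_apply, conjD_apply, conjV_conjV,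
          LinearMap.neg_apply, LinearMap.smul_apply, baseChange_conj, smul_eq_mul, map_neg,
          map_mul, Complex.conj_I] at this
        have h3 : Complex.I * starRingEnd ℂ (Ω.baseChange ℂ X Z) = 0 := by
          linear_combination (-1 / 2 : ℂ) * this
        have h4 := (mul_eq_zero.1 h3).resolve_left Complex.I_ne_zero
        simpa using h4
      have : X = 0 := hinj (by rw [hX, map_zero])
      simp [this]
    · rw [codisjoint_iff, eq_top_iff]
      rintro ⟨X, α⟩ -
      obtain ⟨W, rfl⟩ := hsurj α
      have hA : ∀ A : ℂ ⊗[ℝ] 𝔥, ((A, Complex.I • Ω.baseChange ℂ A) : GenTangent 𝔥) ∈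
          conjSub (LinearMap.range
            (LinearMap.prod (LinearMap.id : (ℂ ⊗[ℝ] 𝔥) →ₗ[ℂ] (ℂ ⊗[ℝ] 𝔥))
              (-(Complex.I • Ω.baseChange ℂ)))) := by
        intro A
        refine ⟨conjV A, ?_⟩
        ext1
        · rfl
        · refine LinearMap.ext fun Z => ?_
          have := baseChange_conj Ω A (conjV Z)
          rw [conjV_conjV] at this
          simp [conjE_apply, conjD_apply, this]
      refine Submodule.mem_sup.2 ⟨_, ⟨(1 / 2 : ℂ) • (X + Complex.I • W), rfl⟩, _,
        hA ((1 / 2 : ℂ) • (X - Complex.I • W)), ?_⟩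
      ext1
      · simp only [LinearMap.prod_apply, Function.prod, LinearMap.id_apply, Prod.mk_add_mk]
        module
      · refine LinearMap.ext fun Z => ?_
        show -(Complex.I * Ω.baseChange ℂ ((1 / 2 : ℂ) • (X + Complex.I • W)) Z)
          + Complex.I * Ω.baseChange ℂ ((1 / 2 : ℂ) • (X - Complex.I • W)) Z
          = Ω.baseChange ℂ W Z
        simp only [LinearMap.smul_apply, map_smul, map_add, map_sub, LinearMap.add_apply,
          LinearMap.sub_apply, smul_eq_mul]
        linear_combination (-(Ω.baseChange ℂ W Z)) * Complex.I_mul_I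
  closed := by
    rintro _ ⟨X, rfl⟩ _ ⟨Y, rfl⟩
    refine ⟨⁅X, Y⁆, ?_⟩
    ext1
    · rfl
    · refine LinearMap.ext fun Z => ?_
      have h := baseChange_closed hΩ.closed X Y Z
      have h1 := baseChange_alt hΩ.isAlt ⁅Y, Z⁆ X
      have h2 := baseChange_alt hΩ.isAlt ⁅X, Z⁆ Y
      have h3 : Ω.baseChange ℂ ⁅Z, X⁆ Y = -Ω.baseChange ℂ ⁅X, Z⁆ Y := by
        rw [cx_lie_skew Z X, map_neg, LinearMap.neg_apply]
      simp only [courant, LinearMap.prod_apply, Function.prod, LinearMap.neg_apply,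
        LinearMap.smul_apply, LinearMap.id_apply, LinearMap.sub_apply, lieDer_apply, smul_eq_mul]
      linear_combination (-Complex.I) * (h - h1 - h3 + h2)

/-- The `B`-field transformation `X + α ↦ X + α + ι_X B` by a real 2-form `B`. -/
def bField (B : LinearMap.BilinForm ℝ 𝔥) : GenTangent 𝔥 →ₗ[ℂ] GenTangent 𝔥 :=
  LinearMap.id + LinearMap.inr ℂ _ _ ∘ₗ (B.baseChange ℂ) ∘ₗ LinearMap.fst ℂ _ _

end Examples

/-! ## The differential Gerstenhaber algebra -/

namespace GenComplex

variable {𝔥 : Type*} [LieRing 𝔥] [LieAlgebra ℝ 𝔥] (𝒥 : GenComplex 𝔥)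

/-- The Courant bracket restricted to `L`. -/
def bracketL (x y : 𝒥.L) : 𝒥.L := ⟨courant (x : GenTangent 𝔥) y, 𝒥.closed _ x.2 _ y.2⟩

/-- The functional `ℓ ↦ σ(a)(ℓ) = 2 ⟨a, ℓ⟩` on `L` defined by a generalized tangent vector `a`. -/
def restrictL : GenTangent 𝔥 →ₗ[ℂ] Module.Dual ℂ 𝒥.L :=
  (Submodule.subtype 𝒥.L).dualMap ∘ₗ sigma

theorem restrictL_apply (a : GenTangent 𝔥) (x : 𝒥.L) :
    𝒥.restrictL a x = sigma a (x : GenTangent 𝔥) := rfl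

theorem sigma_conj (a b : GenTangent 𝔥) :
    sigma (conjE a) (conjE b) = starRingEnd ℂ (sigma a b) := by
  simp [sigma_apply, conjE_apply, conjD_apply]

theorem sigma_eq_zero {a : GenTangent 𝔥} (h : ∀ b, sigma a b = 0) : a = 0 := by
  ext1
  · exact (Module.forall_dual_apply_eq_zero_iff ℂ a.1).1 fun β => by
      simpa [sigma_apply] using h (0, β)
  · exact LinearMap.ext fun Y => by simpa [sigma_apply] using h (Y, 0)

theorem sigma_conjSub {a b : GenTangent 𝔥} (ha : a ∈ conjSub 𝒥.L) (hb : b ∈ conjSub 𝒥.L) :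
    sigma a b = 0 := by
  have h := sigma_conj a b
  rw [sigma_eq_two_pairing, 𝒥.isotropic _ ha _ hb, mul_zero] at h
  simpa using h.symm

theorem sigma_L {a b : GenTangent 𝔥} (ha : a ∈ 𝒥.L) (hb : b ∈ 𝒥.L) : sigma a b = 0 := by
  rw [sigma_eq_two_pairing, 𝒥.isotropic _ ha _ hb, mul_zero]

variable [FiniteDimensional ℝ 𝔥]

theorem sigma_surjective (F : Module.Dual ℂ (GenTangent 𝔥)) : ∃ a, sigma a = F := by
  refine ⟨((Module.evalEquiv ℂ (ℂ ⊗[ℝ] 𝔥)).symm (F ∘ₗ LinearMap.inr ℂ _ _),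
    F ∘ₗ LinearMap.inl ℂ _ _), LinearMap.ext fun b => ?_⟩
  rw [sigma_apply, Module.apply_evalEquiv_symm_apply]
  simp only [LinearMap.comp_apply, LinearMap.inl_apply, LinearMap.inr_apply]
  rw [← map_add]
  simp

theorem restrictL_bijective :
    Function.Bijective (𝒥.restrictL ∘ₗ (conjSub 𝒥.L).subtype) := by
  constructor
  · rw [injective_iff_map_eq_zero]
    intro m hm
    refine Subtype.ext (sigma_eq_zero fun b => ?_)
    obtain ⟨x, hx, y, hy, rfl⟩ := Submodule.mem_sup.1
      (𝒥.isCompl.sup_eq_top ▸ Submodule.mem_top : b ∈ 𝒥.L ⊔ conjSub 𝒥.L)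
    have h1 := LinearMap.congr_fun hm ⟨x, hx⟩
    rw [map_add, 𝒥.sigma_conjSub m.2 hy, add_zero]
    exact h1
  · intro f
    obtain ⟨a, ha⟩ := sigma_surjective (f ∘ₗ Submodule.projectionOnto _ _ 𝒥.isCompl)
    obtain ⟨x, hx, y, hy, rfl⟩ := Submodule.mem_sup.1
      (𝒥.isCompl.sup_eq_top ▸ Submodule.mem_top : a ∈ 𝒥.L ⊔ conjSub 𝒥.L)
    refine ⟨⟨y, hy⟩, LinearMap.ext fun z => ?_⟩
    have h := LinearMap.congr_fun ha (z : GenTangent 𝔥)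
    rw [map_add, LinearMap.add_apply, 𝒥.sigma_L hx z.2, zero_add] at h
    have hz : sigma y (z : GenTangent 𝔥) = f z := by simpa using h
    exact hz

/-- The identification of `conj L` with the dual of `L` given by `σ`. -/
def conjEquivDual : conjSub 𝒥.L ≃ₗ[ℂ] Module.Dual ℂ 𝒥.L :=
  LinearEquiv.ofBijective (𝒥.restrictL ∘ₗ (conjSub 𝒥.L).subtype) 𝒥.restrictL_bijective

/-- The Schouten bracket on `⋀ L`. On decomposable elements it is
`⟦x₁ ∧ ⋯ ∧ xₚ, y₁ ∧ ⋯ ∧ y_q⟧ =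
  ∑ₖₗ (-1)^(k+l) ⟦xₖ, yₗ⟧ ∧ x₁ ∧ ⋯ x̂ₖ ⋯ ∧ xₚ ∧ y₁ ∧ ⋯ ŷₗ ⋯ ∧ y_q`; it is written here
with a basis `e` of `L` and its dual basis `e^*` as
`⟦A, B⟧ = ∑ᵢⱼ (A ⌊ eᵢ^*) ∧ ⟦eᵢ, eⱼ⟧ ∧ (eⱼ^* ⌋ B)`, which does not depend on the basis. -/
def schouten (A B : ExteriorAlgebra ℂ 𝒥.L) : ExteriorAlgebra ℂ 𝒥.L :=
  let e := Module.finBasis ℂ 𝒥.L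
  ∑ i, ∑ j, CliffordAlgebra.contractRight A (e.coord i) *
    ExteriorAlgebra.ι ℂ (𝒥.bracketL (e i) (e j)) * CliffordAlgebra.contractLeft (e.coord j) B

/-- The Lie algebroid differential `∂̄ : ⋀ⁿ L → ⋀ⁿ⁺¹ L` of `conj L`, that is, the
Chevalley-Eilenberg differential of the Lie algebra `conj L` under `L ≅ (conj L)^*`. With a basis
`e` of `L` and the dual basis `m` of `conj L` it is
`∂̄ A = -(1/2) ∑ᵢⱼ eᵢ ∧ eⱼ ∧ (⟦mᵢ, mⱼ⟧ ⌋ A)`, which does not depend on the basis. It is the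
odd derivation with `(∂̄ ℓ)(m, m') = -ℓ(⟦m, m'⟧)` for `ℓ ∈ L` and `m, m' ∈ conj L`. -/
def dbar (A : ExteriorAlgebra ℂ 𝒥.L) : ExteriorAlgebra ℂ 𝒥.L :=
  let e := Module.finBasis ℂ 𝒥.L
  let m : _ → GenTangent 𝔥 := fun i => (𝒥.conjEquivDual.symm (e.coord i) : GenTangent 𝔥)
  (-(1 / 2) : ℂ) • ∑ i, ∑ j, ExteriorAlgebra.ι ℂ (e i) * ExteriorAlgebra.ι ℂ (e j) *
    CliffordAlgebra.contractLeft (𝒥.restrictL (courant (m i) (m j))) A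

/-- An element `Γ` of `⋀² L`, viewed by contraction as a map `conj L → L`. -/
def contraction (Γ : ExteriorAlgebra ℂ 𝒥.L) : conjSub 𝒥.L →ₗ[ℂ] 𝒥.L :=
  ExteriorAlgebra.ιInv ∘ₗ (CliffordAlgebra.contractLeft (Q := (0 : QuadraticForm ℂ 𝒥.L))).flip Γ ∘ₗ
    𝒥.conjEquivDual.toLinearMap

/-- The deformation of `conj L` along `Γ ∈ ⋀² L`: the graph `{m + Γ(m) : m ∈ conj L}`. -/
def deformConj (Γ : ExteriorAlgebra ℂ 𝒥.L) : Submodule ℂ (GenTangent 𝔥) :=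
  LinearMap.range ((conjSub 𝒥.L).subtype + 𝒥.L.subtype ∘ₗ 𝒥.contraction Γ)

/-- The deformation of `L` along `Γ ∈ ⋀² L`: the space `{ℓ + conj(Γ)(ℓ) : ℓ ∈ L}`, which is the
conjugate of `{m + Γ(m) : m ∈ conj L}`. -/
def deform (Γ : ExteriorAlgebra ℂ 𝒥.L) : Submodule ℂ (GenTangent 𝔥) := conjSub (𝒥.deformConj Γ)

/-- An isomorphism between the differential Gerstenhaber algebras
`DGA = (⋀ L, ⟦-, -⟧, ∧, ∂̄)` of two generalized complex structures: a degree preserving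
isomorphism of exterior algebras that respects the Schouten brackets and the differentials. -/
structure DGAEquiv {𝔥' : Type*} [LieRing 𝔥'] [LieAlgebra ℝ 𝔥'] [FiniteDimensional ℝ 𝔥']
    (𝒥₁ : GenComplex 𝔥) (𝒥₂ : GenComplex 𝔥') where
  /-- the underlying isomorphism of exterior algebras -/
  toAlgEquiv : ExteriorAlgebra ℂ 𝒥₁.L ≃ₐ[ℂ] ExteriorAlgebra ℂ 𝒥₂.L
  map_degree : ∀ (n : ℕ) (A : ExteriorAlgebra ℂ 𝒥₁.L),
    A ∈ ⋀[ℂ]^n 𝒥₁.L → toAlgEquiv A ∈ ⋀[ℂ]^n 𝒥₂.L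
  map_schouten : ∀ A B, toAlgEquiv (𝒥₁.schouten A B) =
    𝒥₂.schouten (toAlgEquiv A) (toAlgEquiv B)
  map_dbar : ∀ A, toAlgEquiv (𝒥₁.dbar A) = 𝒥₂.dbar (toAlgEquiv A)

end GenComplex

/-! ## The semi-direct product `𝔤 ⋉_γ V` -/

/-- A flat connection on `𝔤`: a linear map `γ : 𝔤 → End(V)`, where `V` is the underlying vector
space of `𝔤`, that is a representation: `γ([x, y]) = γ(x) γ(y) - γ(y) γ(x)`. -/
structure FlatConnection (𝔤 : Type*) [LieRing 𝔤] [LieAlgebra ℝ 𝔤] where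
  /-- the linear map `γ` -/
  toLinearMap : 𝔤 →ₗ[ℝ] Module.End ℝ 𝔤
  flat : ∀ x y, toLinearMap ⁅x, y⁆ =
    toLinearMap x * toLinearMap y - toLinearMap y * toLinearMap x

instance {𝔤 : Type*} [LieRing 𝔤] [LieAlgebra ℝ 𝔤] :
    CoeFun (FlatConnection 𝔤) (fun _ => 𝔤 → Module.End ℝ 𝔤) := ⟨fun γ => γ.toLinearMap⟩

section SemiDirect

variable {𝔤 : Type*} [LieRing 𝔤] [LieAlgebra ℝ 𝔤]

/-- The underlying vector space `𝔤 ⊕ V` of the semi-direct product `𝔤 ⋉_γ V`, where `V` is the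
underlying vector space of `𝔤` and `γ` is a flat connection. -/
def SemiProd (_γ : FlatConnection 𝔤) : Type _ := 𝔤 × 𝔤

variable (γ : FlatConnection 𝔤)

/-- The connection `γ` is torsion-free. -/
def IsTorsionFree : Prop := ∀ x y, γ x y - γ y x = ⁅x, y⁆

/-- The connection `γ` is symplectic with respect to `ω`. -/
def IsSymplecticConnection (ω : LinearMap.BilinForm ℝ 𝔤) : Prop :=
  ∀ x y z, ω (γ x y) z + ω y (γ x z) = 0

instance : AddCommGroup (SemiProd γ) := inferInstanceAs (AddCommGroup (𝔤 × 𝔤))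

instance : Module ℝ (SemiProd γ) := inferInstanceAs (Module ℝ (𝔤 × 𝔤))

instance [FiniteDimensional ℝ 𝔤] : FiniteDimensional ℝ (SemiProd γ) :=
  inferInstanceAs (FiniteDimensional ℝ (𝔤 × 𝔤))

namespace SemiProd

/-- The first projection. -/
def fst : SemiProd γ →ₗ[ℝ] 𝔤 := LinearMap.fst ℝ 𝔤 𝔤

/-- The second projection. -/
def snd : SemiProd γ →ₗ[ℝ] 𝔤 := LinearMap.snd ℝ 𝔤 𝔤

/-- The pair `(x, u)` with `x ∈ 𝔤` and `u ∈ V`. -/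
def mk (x u : 𝔤) : SemiProd γ := (x, u)

@[simp] theorem fst_mk (x u : 𝔤) : fst γ (mk γ x u) = x := rfl

@[simp] theorem snd_mk (x u : 𝔤) : snd γ (mk γ x u) = u := rfl

variable {γ} in
theorem ext' {a b : SemiProd γ} (h₁ : fst γ a = fst γ b) (h₂ : snd γ a = snd γ b) : a = b :=
  Prod.ext h₁ h₂

/-- The bracket `[(x, u), (y, v)] = ([x, y], γ(x) v - γ(y) u)`. -/
instance : Bracket (SemiProd γ) (SemiProd γ) where
  bracket a b := mk γ ⁅fst γ a, fst γ b⁆ (γ (fst γ a) (snd γ b) - γ (fst γ b) (snd γ a))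

@[simp] theorem fst_lie (a b : SemiProd γ) : fst γ ⁅a, b⁆ = ⁅fst γ a, fst γ b⁆ := rfl

@[simp] theorem snd_lie (a b : SemiProd γ) :
    snd γ ⁅a, b⁆ = γ (fst γ a) (snd γ b) - γ (fst γ b) (snd γ a) := rfl

instance : LieRing (SemiProd γ) where
  add_lie a b c := by
    refine ext' ?_ ?_
    · simp
    · simp; abel
  lie_add a b c := by
    refine ext' ?_ ?_
    · simp
    · simp; abel
  lie_self a := by
    refine ext' ?_ ?_ <;> simp
  leibniz_lie a b c := by
    refine ext' ?_ ?_
    · simp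
    · simp [γ.flat]; abel

instance : LieAlgebra ℝ (SemiProd γ) where
  lie_smul t a b := by
    refine ext' ?_ ?_
    · simp
    · simp [smul_sub]

/-- The complex structure `J(x, u) = (-u, x)`. -/
def J : SemiProd γ →ₗ[ℝ] SemiProd γ :=
  LinearMap.prod (-(LinearMap.snd ℝ 𝔤 𝔤)) (LinearMap.fst ℝ 𝔤 𝔤)

theorem J_mk (x u : 𝔤) : J γ (mk γ x u) = mk γ (-u) x := rfl

/-- `Ω₁((x, u), (y, v)) = -ω(x, v) - ω(u, y)`. -/
def Ω₁ (ω : LinearMap.BilinForm ℝ 𝔤) : LinearMap.BilinForm ℝ (SemiProd γ) :=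
  -(ω.compl₁₂ (fst γ) (snd γ)) - ω.compl₁₂ (snd γ) (fst γ)

theorem Ω₁_mk (ω : LinearMap.BilinForm ℝ 𝔤) (x u y v : 𝔤) :
    Ω₁ γ ω (mk γ x u) (mk γ y v) = -ω x v - ω u y := rfl

/-- `Ω₂((x, u), (y, v)) = ω(x, y) - ω(u, v)`. -/
def Ω₂ (ω : LinearMap.BilinForm ℝ 𝔤) : LinearMap.BilinForm ℝ (SemiProd γ) :=
  ω.compl₁₂ (fst γ) (fst γ) - ω.compl₁₂ (snd γ) (snd γ)

theorem Ω₂_mk (ω : LinearMap.BilinForm ℝ 𝔤) (x u y v : 𝔤) :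
    Ω₂ γ ω (mk γ x u) (mk γ y v) = ω x y - ω u v := rfl

/-- `Ω₃((x, u), (y, v)) = ω(x, y) + ω(u, v)`. -/
def Ω₃ (ω : LinearMap.BilinForm ℝ 𝔤) : LinearMap.BilinForm ℝ (SemiProd γ) :=
  ω.compl₁₂ (fst γ) (fst γ) + ω.compl₁₂ (snd γ) (snd γ)

theorem Ω₃_mk (ω : LinearMap.BilinForm ℝ 𝔤) (x u y v : 𝔤) :
    Ω₃ γ ω (mk γ x u) (mk γ y v) = ω x y + ω u v := rfl

/-- `Δ((x, u), (y, v)) = g(x, y) + g(u, v)`. -/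
def Δ (g : LinearMap.BilinForm ℝ 𝔤) : LinearMap.BilinForm ℝ (SemiProd γ) :=
  g.compl₁₂ (fst γ) (fst γ) + g.compl₁₂ (snd γ) (snd γ)

theorem Δ_mk (g : LinearMap.BilinForm ℝ 𝔤) (x u y v : 𝔤) :
    Δ γ g (mk γ x u) (mk γ y v) = g x y + g u v := rfl

end SemiProd

/-- The endomorphism `g⁻¹ω` of `V`, where `g` and `ω` are viewed as the maps `a ↦ g(a, -)` and
`a ↦ ω(a, -)` from `V` to `V^*`. -/
def invComp [FiniteDimensional ℝ 𝔤] (g : LinearMap.BilinForm ℝ 𝔤) (hg : g.Nondegenerate)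
    (ω : LinearMap.BilinForm ℝ 𝔤) : 𝔤 →ₗ[ℝ] 𝔤 :=
  (LinearMap.BilinForm.toDual g hg).symm.toLinearMap ∘ₗ ω

end SemiDirect

end

end GenGeom

/-! Write `𝔥` for the semi-direct product.

Deformation. The forms satisfy `Ω₁ = Ω₂(J-, -)` and both are symplectic. The bivector is a constant
multiple of the inverse of `Ω₂`, restricted to forms of type `(1,0)`. The deformed space at time `t`
then consists of the `Z + α` with `α` of type `(0,1)` and `ι_Z(Ω₁ - iΩ₂) = tα`. At `t = 0` this is
`L_J`, because `Ω₁ - iΩ₂ = Ω₂((J - i)-, -)`. For `t ≠ 0` the type condition is automatic and the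
space is the transform of the symplectic structure `t⁻¹Ω₂` by the closed form `t⁻¹Ω₁`. Integrability
is thus visible for every `t` without solving a Maurer-Cartan equation; see `exists_deform_eq`.

Isomorphism. A differential Gerstenhaber algebra of this kind is determined by the Lie algebras `L`
and `conj L` and the pairing between them. Both `L_J` and `L_{Ω₂}` are isomorphic to `𝔥_ℂ` as Lie
algebras: the second by `X ↦ X - iι_XΩ₂`, the first because the `(1,0)`-vectors form a copy of `𝔤_ℂ`
and the symplectic connection identifies the `(0,1)`-forms with `V_ℂ` (`complexMap`). Under these
identifications the pairing of `conj X` with `Y` becomes `-2iΩ₁(Y, conj X)` and `-2iΩ₂(Y, conj X)`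
respectively. It remains to find two automorphisms `A`, `B` of the real Lie algebra `𝔥` with `Ω₂(A-,
B-) = Ω₁`.

Automorphisms. Let `T = g⁻¹ω`. The hypotheses give `T(γ(a)b) = γ(Ta)(Tb)`, skewness of `T` for `ω`,
`γ(T²x) = γ(x)`, and, from the closed fundamental form, `γ(x - Tx)y = γ(y - Ty)x`. If `T² = 1`, one
would split `V` into the eigenspaces of `T` for `1` and `-1`. Since only `γ ∘ T² = γ` is available,
the Fitting decompositions of `T + 1` and `T - 1` are used instead. They give projections `P` (onto
the generalized eigenspace for `-1`) and `Q` (along the one for `1`). The map equal to `J` on the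
range of such a projection and to the identity on its kernel is an automorphism. Skewness of `T`
makes `ω` pair the range of `P` only with the kernel of `Q` and the kernel of `P` only with the
range of `Q`, so exactly one `J` enters each nonzero term of `Ω₂(A-, B-)`, which turns it into `Ω₁`.
-/

namespace GenGeom

/-! ### Naturality and basis independence of operations on exterior algebras. -/

open CliffordAlgebra in
/-- Contraction on the left is natural in the module. -/
theorem map_contractLeft {K M N : Type*} [CommRing K] [AddCommGroup M] [Module K M]
    [AddCommGroup N] [Module K N] (φ : M →ₗ[K] N) (d : Module.Dual K N)
    (A : ExteriorAlgebra K M) :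
    ExteriorAlgebra.map φ (contractLeft (Q := (0 : QuadraticForm K M)) (d ∘ₗ φ) A) =
      contractLeft (Q := (0 : QuadraticForm K N)) d (ExteriorAlgebra.map φ A) := by
  induction A using CliffordAlgebra.left_induction with
  | algebraMap r => simp [contractLeft_algebraMap]
  | add x y hx hy => simp only [map_add, hx, hy]
  | ι_mul x m hx =>
    have h (x : ExteriorAlgebra K M) : ExteriorAlgebra.map φ (ι 0 m * x) =
        ι 0 (φ m) * ExteriorAlgebra.map φ x := by
      rw [map_mul]; congr 1; exact ExteriorAlgebra.map_apply_ι φ m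
    rw [contractLeft_ι_mul, map_sub, map_smul, h, h, hx, contractLeft_ι_mul]
    rfl

open CliffordAlgebra in
/-- Contraction on the right is natural in the module. -/
theorem map_contractRight {K M N : Type*} [CommRing K] [AddCommGroup M] [Module K M]
    [AddCommGroup N] [Module K N] (φ : M →ₗ[K] N) (d : Module.Dual K N)
    (A : ExteriorAlgebra K M) :
    ExteriorAlgebra.map φ (contractRight (Q := (0 : QuadraticForm K M)) A (d ∘ₗ φ)) =
      contractRight (Q := (0 : QuadraticForm K N)) (ExteriorAlgebra.map φ A) d := by
  induction A using CliffordAlgebra.right_induction with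
  | algebraMap r => simp [contractRight_algebraMap]
  | add x y hx hy => simp only [map_add, LinearMap.add_apply, hx, hy]
  | mul_ι m x hx =>
    have h (x : ExteriorAlgebra K M) : ExteriorAlgebra.map φ (x * ι 0 m) =
        ExteriorAlgebra.map φ x * ι 0 (φ m) := by
      rw [map_mul]; congr 1; exact ExteriorAlgebra.map_apply_ι φ m
    rw [contractRight_mul_ι, map_sub, map_smul, h, h, hx, contractRight_mul_ι]
    rfl

/-- The canonical element `∑ eᵢ ⊗ eᵢ^*` does not depend on the basis. -/
theorem sum_basis_coord_eq {K M X ι κ : Type*} [CommRing K] [AddCommGroup M] [Module K M]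
    [AddCommGroup X] [Module K X] [Fintype ι] [Fintype κ]
    (e : Module.Basis ι K M) (f : Module.Basis κ K M)
    (F : M →ₗ[K] Module.Dual K M →ₗ[K] X) :
    ∑ i, F (e i) (e.coord i) = ∑ j, F (f j) (f.coord j) := by
  classical
  have h1 : ∀ i, F (e i) (e.coord i) = ∑ j, F (f j) (f.coord j (e i) • e.coord i) := by
    intro i
    calc F (e i) (e.coord i) = F (∑ j, f.repr (e i) j • f j) (e.coord i) := by rw [f.sum_repr]
      _ = _ := by simp only [map_sum, LinearMap.sum_apply, map_smul, LinearMap.smul_apply,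
        Module.Basis.coord_apply]
  rw [Finset.sum_congr rfl fun i _ => h1 i, Finset.sum_comm]
  refine Finset.sum_congr rfl fun j _ => ?_
  rw [← map_sum, e.sum_dual_apply_smul_coord]

/-- The two-fold version, changing one basis at a time. Bilinearity is only asked of each pair of
arguments separately, which fits expressions such as the Schouten bracket without currying them into
a four-fold linear map. -/
theorem sum_basis_coord_eq₂ {K M X ι κ : Type*} [CommRing K] [AddCommGroup M] [Module K M]
    [AddCommGroup X] [Module K X] [Fintype ι] [Fintype κ]
    (e : Module.Basis ι K M) (f : Module.Basis κ K M)
    (F : M → Module.Dual K M → M → Module.Dual K M → X)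
    (hF₁ : ∀ y d', ∃ G : M →ₗ[K] Module.Dual K M →ₗ[K] X, ∀ x d, F x d y d' = G x d)
    (hF₂ : ∀ x d, ∃ G : M →ₗ[K] Module.Dual K M →ₗ[K] X, ∀ y d', F x d y d' = G y d') :
    ∑ i, ∑ j, F (e i) (e.coord i) (e j) (e.coord j) =
      ∑ i, ∑ j, F (f i) (f.coord i) (f j) (f.coord j) := by
  trans ∑ i, ∑ j, F (e i) (e.coord i) (f j) (f.coord j)
  · refine Finset.sum_congr rfl fun i _ => ?_
    obtain ⟨G, hG⟩ := hF₂ (e i) (e.coord i)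
    simp only [hG]
    exact sum_basis_coord_eq e f G
  · rw [Finset.sum_comm]
    conv_rhs => rw [Finset.sum_comm]
    refine Finset.sum_congr rfl fun j _ => ?_
    obtain ⟨G, hG⟩ := hF₁ (f j) (f.coord j)
    simp only [hG]
    exact sum_basis_coord_eq e f G

theorem coord_map_comp {K M N ι : Type*} [CommRing K] [AddCommGroup M] [Module K M]
    [AddCommGroup N] [Module K N] (e : Module.Basis ι K M) (φ : M ≃ₗ[K] N) (i : ι) :
    (e.map φ).coord i ∘ₗ φ.toLinearMap = e.coord i := by
  ext x; simp

open CliffordAlgebra in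
/-- Naturality, and independence of the bases, of the bracket on an exterior algebra induced by a
bilinear map. -/
theorem map_sum_schouten {K M N ι κ : Type*} [CommRing K] [AddCommGroup M] [Module K M]
    [AddCommGroup N] [Module K N] [Fintype ι] [Fintype κ]
    (e : Module.Basis ι K M) (f : Module.Basis κ K N) (φ : M ≃ₗ[K] N)
    (β : M →ₗ[K] M →ₗ[K] M) (β' : N →ₗ[K] N →ₗ[K] N)
    (h : ∀ x y, φ (β x y) = β' (φ x) (φ y)) (A B : ExteriorAlgebra K M) :
    ExteriorAlgebra.map φ.toLinearMap (∑ i, ∑ j,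
      contractRight (Q := (0 : QuadraticForm K M)) A (e.coord i) *
        ExteriorAlgebra.ι K (β (e i) (e j)) * contractLeft (e.coord j) B) =
    ∑ i, ∑ j, contractRight (Q := (0 : QuadraticForm K N))
        (ExteriorAlgebra.map φ.toLinearMap A) (f.coord i) *
      ExteriorAlgebra.ι K (β' (f i) (f j)) *
        contractLeft (f.coord j) (ExteriorAlgebra.map φ.toLinearMap B) := by
  rw [← sum_basis_coord_eq₂ (e.map φ) f (fun x d y d' =>
    contractRight (Q := (0 : QuadraticForm K N)) (ExteriorAlgebra.map φ.toLinearMap A) d *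
      ExteriorAlgebra.ι K (β' x y) *
        contractLeft d' (ExteriorAlgebra.map φ.toLinearMap B))]
  · simp only [map_sum]
    refine Finset.sum_congr rfl fun i _ => Finset.sum_congr rfl fun j _ => ?_
    rw [map_mul, map_mul, ExteriorAlgebra.map_apply_ι, ← map_contractLeft, ← map_contractRight,
      coord_map_comp, coord_map_comp]
    simp only [LinearEquiv.coe_coe, h, Module.Basis.map_apply]
  · intro y d'
    exact ⟨LinearMap.mk₂ K (fun x d =>
      contractRight (Q := (0 : QuadraticForm K N)) (ExteriorAlgebra.map φ.toLinearMap A) d *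
      ExteriorAlgebra.ι K (β' x y) *
        contractLeft d' (ExteriorAlgebra.map φ.toLinearMap B))
      (by intros; simp [mul_add, add_mul]) (by intros; simp)
      (by intros; simp [add_mul]) (by intros; simp), fun _ _ => rfl⟩
  · intro x d
    exact ⟨LinearMap.mk₂ K (fun y d' =>
      contractRight (Q := (0 : QuadraticForm K N)) (ExteriorAlgebra.map φ.toLinearMap A) d *
      ExteriorAlgebra.ι K (β' x y) *
        contractLeft d' (ExteriorAlgebra.map φ.toLinearMap B))
      (by intros; simp [mul_add, add_mul]) (by intros; simp)
      (by intros; simp [mul_add]) (by intros; simp), fun _ _ => rfl⟩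

open CliffordAlgebra in
/-- Naturality, and independence of the bases, of the derivation of an exterior algebra induced by
a bilinear map on the dual. -/
theorem map_sum_differential {K M N ι κ : Type*} [CommRing K] [AddCommGroup M] [Module K M]
    [AddCommGroup N] [Module K N] [Fintype ι] [Fintype κ]
    (e : Module.Basis ι K M) (f : Module.Basis κ K N) (φ : M ≃ₗ[K] N)
    (c : Module.Dual K M →ₗ[K] Module.Dual K M →ₗ[K] Module.Dual K M)
    (c' : Module.Dual K N →ₗ[K] Module.Dual K N →ₗ[K] Module.Dual K N)
    (h : ∀ d d', c (d ∘ₗ φ.toLinearMap) (d' ∘ₗ φ.toLinearMap) = c' d d' ∘ₗ φ.toLinearMap)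
    (A : ExteriorAlgebra K M) :
    ExteriorAlgebra.map φ.toLinearMap (∑ i, ∑ j,
      ExteriorAlgebra.ι K (e i) * ExteriorAlgebra.ι K (e j) *
        contractLeft (Q := (0 : QuadraticForm K M)) (c (e.coord i) (e.coord j)) A) =
    ∑ i, ∑ j, ExteriorAlgebra.ι K (f i) * ExteriorAlgebra.ι K (f j) *
        contractLeft (Q := (0 : QuadraticForm K N)) (c' (f.coord i) (f.coord j))
          (ExteriorAlgebra.map φ.toLinearMap A) := by
  rw [← sum_basis_coord_eq₂ (e.map φ) f (fun x d y d' =>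
    ExteriorAlgebra.ι K x * ExteriorAlgebra.ι K y *
        contractLeft (Q := (0 : QuadraticForm K N)) (c' d d')
          (ExteriorAlgebra.map φ.toLinearMap A))]
  · simp only [map_sum]
    refine Finset.sum_congr rfl fun i _ => Finset.sum_congr rfl fun j _ => ?_
    rw [map_mul, map_mul, ExteriorAlgebra.map_apply_ι, ExteriorAlgebra.map_apply_ι,
      ← map_contractLeft, ← h, coord_map_comp, coord_map_comp]
    simp only [LinearEquiv.coe_coe, Module.Basis.map_apply]
  · intro y d'
    exact ⟨LinearMap.mk₂ K (fun x d =>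
      ExteriorAlgebra.ι K x * ExteriorAlgebra.ι K y *
        contractLeft (Q := (0 : QuadraticForm K N)) (c' d d')
          (ExteriorAlgebra.map φ.toLinearMap A))
      (by intros; simp [add_mul]) (by intros; simp)
      (by intros; simp [mul_add]) (by intros; simp), fun _ _ => rfl⟩
  · intro x d
    exact ⟨LinearMap.mk₂ K (fun y d' =>
      ExteriorAlgebra.ι K x * ExteriorAlgebra.ι K y *
        contractLeft (Q := (0 : QuadraticForm K N)) (c' d d')
          (ExteriorAlgebra.map φ.toLinearMap A))
      (by intros; simp [mul_add, add_mul]) (by intros; simp)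
      (by intros; simp [mul_add]) (by intros; simp), fun _ _ => rfl⟩

open CliffordAlgebra in
/-- A skew map from the dual of `M` to `M` is the contraction with a bivector. -/
theorem exists_bivector_contractLeft {K M : Type*} [Field K] [CharZero K] [AddCommGroup M]
    [Module K M] [FiniteDimensional K M] (D : Module.Dual K M →ₗ[K] M)
    (hD : ∀ d d' : Module.Dual K M, d (D d') = -d' (D d)) :
    ∃ Λ ∈ ⋀[K]^2 M, ∀ d, contractLeft (Q := (0 : QuadraticForm K M)) d Λ =
      ExteriorAlgebra.ι K (D d) := by
  let e := Module.finBasis K M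
  -- Contracting `eᵢ ∧ D(eᵢ^*)` with `d` gives two terms. By skewness of `D` each of them sums to `D
  -- d`, whence the factor `1/2`.
  refine ⟨(1 / 2 : K) • ∑ i, ExteriorAlgebra.ι K (e i) * ExteriorAlgebra.ι K (D (e.coord i)),
    Submodule.smul_mem _ _ (Submodule.sum_mem _ fun i _ => ?_), fun d => ?_⟩
  · change _ ∈ LinearMap.range (ExteriorAlgebra.ι K) ^ 2
    rw [pow_two]
    exact Submodule.mul_mem_mul ⟨_, rfl⟩ ⟨_, rfl⟩
  · have h1 : ∀ i, contractLeft (Q := (0 : QuadraticForm K M)) d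
        (ExteriorAlgebra.ι K (e i) * ExteriorAlgebra.ι K (D (e.coord i))) =
        ExteriorAlgebra.ι K (D (d (e i) • e.coord i)) +
          ExteriorAlgebra.ι K (e.coord i (D d) • e i) := by
      intro i
      have h2 := contractLeft_ι_mul (Q := (0 : QuadraticForm K M)) (d := d) (e i)
        (ExteriorAlgebra.ι K (D (e.coord i)))
      have h3 := contractLeft_ι (Q := (0 : QuadraticForm K M)) d (D (e.coord i))
      refine h2.trans ?_
      erw [h3]
      rw [hD, ← Algebra.commutes, ← Algebra.smul_def, neg_smul, sub_neg_eq_add, map_smul, map_smul,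
        map_smul]
    rw [map_smul, map_sum, Finset.sum_congr rfl fun i _ => h1 i, Finset.sum_add_distrib,
      ← map_sum, ← map_sum, ← map_sum, e.sum_dual_apply_smul_coord]
    have h4 : ∑ i, e.coord i (D d) • e i = D d := e.sum_repr (D d)
    rw [h4, ← two_smul K, smul_smul]
    norm_num

end GenGeom

namespace GenGeom

noncomputable section

/-! ### Complex bilinearity of the Courant bracket and its compatibility with conjugation. -/

section Courant

variable {𝔥 : Type*} [LieRing 𝔥] [LieAlgebra ℝ 𝔥]

/-- Two complex bilinear maps on a complexification agree if they agree on real vectors. -/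
theorem complexification_ext₂ {X : Type*} [AddCommGroup X] [Module ℂ X]
    {F G : (ℂ ⊗[ℝ] 𝔥) →ₗ[ℂ] (ℂ ⊗[ℝ] 𝔥) →ₗ[ℂ] X}
    (h : ∀ x y, F (1 ⊗ₜ x) (1 ⊗ₜ y) = G (1 ⊗ₜ x) (1 ⊗ₜ y)) : F = G := by
  have key : ∀ (z : ℂ) (x : 𝔥), (z ⊗ₜ[ℝ] x : ℂ ⊗[ℝ] 𝔥) = z • ((1 : ℂ) ⊗ₜ[ℝ] x) := by
    intro z x; rw [TensorProduct.smul_tmul', smul_eq_mul, mul_one]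
  refine LinearMap.ext fun X => LinearMap.ext fun Y => ?_
  induction X with
  | zero => simp
  | add x x' hx hx' => simp [hx, hx']
  | tmul z v =>
    induction Y with
    | zero => simp
    | add y y' hy hy' => simp only [map_add, hy, hy']
    | tmul w u =>
      rw [key z v, key w u]
      simp only [map_smul, LinearMap.smul_apply, h]

/-- The Lie bracket of the complexification as a bilinear map. -/
def cxBracket : (ℂ ⊗[ℝ] 𝔥) →ₗ[ℂ] (ℂ ⊗[ℝ] 𝔥) →ₗ[ℂ] (ℂ ⊗[ℝ] 𝔥) :=
  LinearMap.mk₂ ℂ (fun X Y => ⁅X, Y⁆) cx_add_lie cx_smul_lie cx_lie_add cx_lie_smul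

theorem cxBracket_apply (X Y : ℂ ⊗[ℝ] 𝔥) : cxBracket X Y = ⁅X, Y⁆ := rfl

/-- The Courant bracket as a bilinear map. -/
def courantBilin : GenTangent 𝔥 →ₗ[ℂ] GenTangent 𝔥 →ₗ[ℂ] GenTangent 𝔥 :=
  LinearMap.mk₂ ℂ courant
    (fun a b c => by
      ext1
      · exact cx_add_lie _ _ _
      · refine LinearMap.ext fun Z => ?_
        simp only [courant, lieDer_apply, LinearMap.sub_apply, Prod.fst_add, Prod.snd_add,
          LinearMap.add_apply, cx_add_lie, map_add]
        ring)
    (fun r a b => by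
      ext1
      · exact cx_smul_lie _ _ _
      · refine LinearMap.ext fun Z => ?_
        simp only [courant, lieDer_apply, LinearMap.sub_apply, Prod.smul_fst, Prod.smul_snd,
          LinearMap.smul_apply, cx_smul_lie, map_smul, smul_eq_mul]
        ring)
    (fun a b c => by
      ext1
      · exact cx_lie_add _ _ _
      · refine LinearMap.ext fun Z => ?_
        simp only [courant, lieDer_apply, LinearMap.sub_apply, Prod.fst_add, Prod.snd_add,
          LinearMap.add_apply, cx_add_lie, map_add]
        ring)
    (fun r a b => by
      ext1
      · exact cx_lie_smul _ _ _
      · refine LinearMap.ext fun Z => ?_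
        simp only [courant, lieDer_apply, LinearMap.sub_apply, Prod.smul_fst, Prod.smul_snd,
          LinearMap.smul_apply, cx_smul_lie, map_smul, smul_eq_mul]
        ring)

theorem courantBilin_apply (a b : GenTangent 𝔥) : courantBilin a b = courant a b := rfl

theorem conjV_lie (X Y : ℂ ⊗[ℝ] 𝔥) : conjV ⁅X, Y⁆ = ⁅conjV X, conjV Y⁆ := by
  induction X with
  | zero => simp
  | add x x' hx hx' => simp only [map_add, cx_add_lie, hx, hx']
  | tmul z v =>
    induction Y with
    | zero => simp [cx_lie_zero]
    | add y y' hy hy' => simp only [map_add, cx_lie_add, hy, hy']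
    | tmul w u => simp [LieAlgebra.ExtendScalars.bracket_tmul]

theorem conjE_conjE (a : GenTangent 𝔥) : conjE (conjE a) = a := by
  ext1
  · simp [conjE_apply]
  · refine LinearMap.ext fun X => ?_
    simp [conjE_apply, conjD_apply]

theorem conjE_courant (a b : GenTangent 𝔥) :
    conjE (courant a b) = courant (conjE a) (conjE b) := by
  ext1
  · exact conjV_lie _ _
  · refine LinearMap.ext fun X => ?_
    simp only [courant, conjE_apply, conjD_apply, lieDer_apply, LinearMap.sub_apply, map_sub,
      map_neg, conjV_lie, conjV_conjV]

theorem sigma_comm (a b : GenTangent 𝔥) : sigma a b = sigma b a := by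
  simp only [sigma_apply]; ring

end Courant

/-! ### Isomorphisms of differential Gerstenhaber algebras from Lie algebra isomorphisms. -/

namespace GenComplex

variable {𝔥 𝔥' : Type*} [LieRing 𝔥] [LieAlgebra ℝ 𝔥] [LieRing 𝔥'] [LieAlgebra ℝ 𝔥']

/-- The bracket of `L` as a bilinear map. -/
def bracketBilin (𝒥 : GenComplex 𝔥) : 𝒥.L →ₗ[ℂ] 𝒥.L →ₗ[ℂ] 𝒥.L :=
  LinearMap.mk₂ ℂ 𝒥.bracketL
    (fun a b c => Subtype.ext (courantBilin.map_add₂ (a : GenTangent 𝔥) b c))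
    (fun r a b => Subtype.ext (courantBilin.map_smul₂ r (a : GenTangent 𝔥) b))
    (fun a b c => Subtype.ext (map_add (courantBilin (a : GenTangent 𝔥)) (b : GenTangent 𝔥) c))
    (fun r a b => Subtype.ext (map_smul (courantBilin (a : GenTangent 𝔥)) r (b : GenTangent 𝔥)))

/-- The conjugate of an element of `L`. -/
def conjL (𝒥 : GenComplex 𝔥) (x : 𝒥.L) : conjSub 𝒥.L :=
  ⟨conjE (x : GenTangent 𝔥), by rw [mem_conjSub, conjE_conjE]; exact x.2⟩

/-- The conjugate of an element of `conj L`. -/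
def unconjL (𝒥 : GenComplex 𝔥) (x : conjSub 𝒥.L) : 𝒥.L := ⟨conjE (x : GenTangent 𝔥), x.2⟩

theorem conjL_unconjL (𝒥 : GenComplex 𝔥) (x : conjSub 𝒥.L) : 𝒥.conjL (𝒥.unconjL x) = x :=
  Subtype.ext (conjE_conjE _)

theorem coe_conjL_bracketL (𝒥 : GenComplex 𝔥) (x y : 𝒥.L) :
    (𝒥.conjL (𝒥.bracketL x y) : GenTangent 𝔥) =
      courant (𝒥.conjL x : GenTangent 𝔥) (𝒥.conjL y : GenTangent 𝔥) :=
  conjE_courant _ _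

variable [FiniteDimensional ℝ 𝔥] [FiniteDimensional ℝ 𝔥']

/-- The bracket of `conj L` transported to the dual of `L`. -/
def dualBracket (𝒥 : GenComplex 𝔥) :
    Module.Dual ℂ 𝒥.L →ₗ[ℂ] Module.Dual ℂ 𝒥.L →ₗ[ℂ] Module.Dual ℂ 𝒥.L :=
  (courantBilin.compl₁₂ ((conjSub 𝒥.L).subtype ∘ₗ 𝒥.conjEquivDual.symm.toLinearMap)
    ((conjSub 𝒥.L).subtype ∘ₗ 𝒥.conjEquivDual.symm.toLinearMap)).compr₂ 𝒥.restrictL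

theorem dualBracket_apply (𝒥 : GenComplex 𝔥) (d d' : Module.Dual ℂ 𝒥.L) :
    𝒥.dualBracket d d' = 𝒥.restrictL (courant (𝒥.conjEquivDual.symm d : GenTangent 𝔥)
      (𝒥.conjEquivDual.symm d' : GenTangent 𝔥)) := rfl

theorem conjEquivDual_apply (𝒥 : GenComplex 𝔥) (m : conjSub 𝒥.L) :
    𝒥.conjEquivDual m = 𝒥.restrictL (m : GenTangent 𝔥) := rfl

/-- The differential `∂̄` is natural for isomorphisms of the Lie algebras `conj L`. -/
theorem map_dbar_of_lieEquiv (𝒥₁ : GenComplex 𝔥) (𝒥₂ : GenComplex 𝔥')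
    (φ χ : 𝒥₁.L ≃ₗ[ℂ] 𝒥₂.L)
    (hχ : ∀ x y, χ (𝒥₁.bracketL x y) = 𝒥₂.bracketL (χ x) (χ y))
    (h : ∀ x y, sigma (conjE (χ x : GenTangent 𝔥')) (φ y : GenTangent 𝔥') =
      sigma (conjE (x : GenTangent 𝔥)) (y : GenTangent 𝔥)) (A : ExteriorAlgebra ℂ 𝒥₁.L) :
    ExteriorAlgebra.map φ.toLinearMap (𝒥₁.dbar A) =
      𝒥₂.dbar (ExteriorAlgebra.map φ.toLinearMap A) := by
  -- The hypothesis `h` says that, under `conj L ≅ L^*`, the conjugate of `χ` is inverse to the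
  -- transpose of `φ`. Hence pulling functionals back along `φ` respects the brackets of the `conj
  -- L`, which is the input of `map_sum_differential`.
  have hψ : ∀ x : 𝒥₁.L, 𝒥₂.conjEquivDual (𝒥₂.conjL (χ x)) ∘ₗ φ.toLinearMap =
      𝒥₁.conjEquivDual (𝒥₁.conjL x) := fun x => LinearMap.ext fun y => h x y
  have hsymm : ∀ (d : Module.Dual ℂ 𝒥₂.L) (x : 𝒥₁.L),
      𝒥₁.conjEquivDual.symm (d ∘ₗ φ.toLinearMap) = 𝒥₁.conjL x →
      𝒥₂.conjEquivDual.symm d = 𝒥₂.conjL (χ x) := by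
    intro d x hx
    rw [LinearEquiv.symm_apply_eq] at hx ⊢
    rw [← hψ] at hx
    refine LinearMap.ext fun y => ?_
    obtain ⟨z, rfl⟩ := φ.surjective y
    exact LinearMap.congr_fun hx z
  have hc := map_sum_differential (Module.finBasis ℂ 𝒥₁.L) (Module.finBasis ℂ 𝒥₂.L) φ
    𝒥₁.dualBracket 𝒥₂.dualBracket (fun d d' => by
      obtain ⟨x, hx⟩ : ∃ x, 𝒥₁.conjEquivDual.symm (d ∘ₗ φ.toLinearMap) = 𝒥₁.conjL x :=
        ⟨_, (𝒥₁.conjL_unconjL _).symm⟩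
      obtain ⟨x', hx'⟩ : ∃ x, 𝒥₁.conjEquivDual.symm (d' ∘ₗ φ.toLinearMap) = 𝒥₁.conjL x :=
        ⟨_, (𝒥₁.conjL_unconjL _).symm⟩
      rw [dualBracket_apply, dualBracket_apply, hsymm d x hx, hsymm d' x' hx', hx, hx']
      have h3 := hψ (𝒥₁.bracketL x x')
      rw [hχ, conjEquivDual_apply, conjEquivDual_apply, coe_conjL_bracketL,
        coe_conjL_bracketL] at h3
      exact h3.symm) A
  rw [dbar, map_smul]
  exact congrArg ((-(1 / 2) : ℂ) • ·) hc

/-- An isomorphism of the Lie algebras `L`, together with an isomorphism of their conjugates that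
is dual to it, induces an isomorphism of differential Gerstenhaber algebras. The isomorphism of the
conjugates is given as the conjugate of an isomorphism `χ` of the Lie algebras `L`. -/
def DGAEquiv.ofLieEquiv (𝒥₁ : GenComplex 𝔥) (𝒥₂ : GenComplex 𝔥')
    (φ χ : 𝒥₁.L ≃ₗ[ℂ] 𝒥₂.L)
    (hφ : ∀ x y, φ (𝒥₁.bracketL x y) = 𝒥₂.bracketL (φ x) (φ y))
    (hχ : ∀ x y, χ (𝒥₁.bracketL x y) = 𝒥₂.bracketL (χ x) (χ y))
    (h : ∀ x y, sigma (conjE (χ x : GenTangent 𝔥')) (φ y : GenTangent 𝔥') =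
      sigma (conjE (x : GenTangent 𝔥)) (y : GenTangent 𝔥)) : DGAEquiv 𝒥₁ 𝒥₂ where
  toAlgEquiv := AlgEquiv.ofAlgHom (ExteriorAlgebra.map φ.toLinearMap)
    (ExteriorAlgebra.map φ.symm.toLinearMap)
    (by rw [ExteriorAlgebra.map_comp_map]; simp)
    (by rw [ExteriorAlgebra.map_comp_map]; simp)
  map_degree n A hA := by
    have h1 : (⋀[ℂ]^n 𝒥₁.L).map (ExteriorAlgebra.map φ.toLinearMap).toLinearMap ≤
        ⋀[ℂ]^n 𝒥₂.L := by
      change (LinearMap.range (ExteriorAlgebra.ι ℂ) ^ n).map _ ≤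
        LinearMap.range (ExteriorAlgebra.ι ℂ) ^ n
      rw [Submodule.map_pow, ExteriorAlgebra.ι_range_map_map]
      exact pow_le_pow_left' (LinearMap.map_le_range) n
    exact h1 ⟨A, hA, rfl⟩
  map_schouten A B :=
    map_sum_schouten (Module.finBasis ℂ 𝒥₁.L) (Module.finBasis ℂ 𝒥₂.L) φ 𝒥₁.bracketBilin
      𝒥₂.bracketBilin hφ A B
  map_dbar A := map_dbar_of_lieEquiv 𝒥₁ 𝒥₂ φ χ hχ h A

end GenComplex

end

end GenGeom

namespace GenGeom

noncomputable section

/-! ### Transformations by closed real 2-forms. -/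

section BField

variable {𝔥 : Type*} [LieRing 𝔥] [LieAlgebra ℝ 𝔥]

theorem bField_apply (B : LinearMap.BilinForm ℝ 𝔥) (a : GenTangent 𝔥) :
    bField B a = (a.1, a.2 + B.baseChange ℂ a.1) := by
  ext1 <;> simp [bField]

theorem pairing_bField {B : LinearMap.BilinForm ℝ 𝔥} (hB : B.IsAlt) (a b : GenTangent 𝔥) :
    pairing (bField B a) (bField B b) = pairing a b := by
  simp only [bField_apply, pairing, LinearMap.add_apply, baseChange_alt hB b.1 a.1]
  ring

theorem courant_bField {B : LinearMap.BilinForm ℝ 𝔥} (hB : B.IsAlt) (hB' : IsClosedForm B)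
    (a b : GenTangent 𝔥) :
    courant (bField B a) (bField B b) = bField B (courant a b) := by
  simp only [bField_apply]
  ext1
  · rfl
  · refine LinearMap.ext fun Z => ?_
    have h := baseChange_closed hB' a.1 b.1 Z
    have h1 := baseChange_alt hB ⁅b.1, Z⁆ a.1
    have h2 : B.baseChange ℂ ⁅Z, a.1⁆ b.1 = B.baseChange ℂ b.1 ⁅a.1, Z⁆ := by
      rw [cx_lie_skew Z a.1, map_neg, LinearMap.neg_apply, ← baseChange_alt hB]
    simp only [courant, lieDer_apply, LinearMap.sub_apply, LinearMap.add_apply]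
    linear_combination -h + h1 + h2

theorem conjE_bField (B : LinearMap.BilinForm ℝ 𝔥) (a : GenTangent 𝔥) :
    conjE (bField B a) = bField B (conjE a) := by
  simp only [bField_apply, conjE_apply]
  ext1
  · rfl
  · refine LinearMap.ext fun Z => ?_
    have := baseChange_conj B a.1 (conjV Z)
    rw [conjV_conjV] at this
    simp [conjD_apply, this]

/-- The `B`-field transformation is invertible. -/
def bFieldEquiv (B : LinearMap.BilinForm ℝ 𝔥) : GenTangent 𝔥 ≃ₗ[ℂ] GenTangent 𝔥 :=
  { bField B with
    invFun := fun a => (a.1, a.2 - B.baseChange ℂ a.1)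
    left_inv := fun a => by simp [bField_apply]
    right_inv := fun a => by simp [bField_apply] }

theorem conjSub_map_bField (B : LinearMap.BilinForm ℝ 𝔥) (L : Submodule ℂ (GenTangent 𝔥)) :
    conjSub (L.map (bField B)) = (conjSub L).map (bField B) := by
  ext a
  constructor
  · rintro ⟨b, hb, hab⟩
    refine ⟨conjE b, ?_, ?_⟩
    · change conjE (conjE b) ∈ L
      rwa [conjE_conjE]
    · rw [← conjE_bField, hab, conjE_conjE]
  · rintro ⟨b, hb, rfl⟩
    exact ⟨conjE b, hb, (conjE_bField B b).symm⟩

/-- A `B`-field transformation by a closed form preserves generalized complex structures. -/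
def GenComplex.bTransform (𝒥 : GenComplex 𝔥) {B : LinearMap.BilinForm ℝ 𝔥} (hB : B.IsAlt)
    (hB' : IsClosedForm B) : GenComplex 𝔥 where
  L := 𝒥.L.map (bField B)
  isotropic := by
    rintro _ ⟨a, ha, rfl⟩ _ ⟨b, hb, rfl⟩
    rw [pairing_bField hB, 𝒥.isotropic a ha b hb]
  isCompl := by
    rw [conjSub_map_bField]
    exact (Submodule.orderIsoMapComap (bFieldEquiv B)).isCompl 𝒥.isCompl
  closed := by
    rintro _ ⟨a, ha, rfl⟩ _ ⟨b, hb, rfl⟩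
    exact ⟨_, 𝒥.closed a ha b hb, (courant_bField hB hB' a b).symm⟩

end BField

/-! ### Bivectors as skew maps from `conj L` to `L`. -/

namespace GenComplex

variable {𝔥 : Type*} [LieRing 𝔥] [LieAlgebra ℝ 𝔥] [FiniteDimensional ℝ 𝔥] (𝒥 : GenComplex 𝔥)

/-- A map from `conj L` to `L` that is skew for the pairing is the contraction with a bivector. -/
theorem exists_contraction_eq (θ : conjSub 𝒥.L →ₗ[ℂ] 𝒥.L)
    (hθ : ∀ m m' : conjSub 𝒥.L, sigma (m' : GenTangent 𝔥) (θ m : GenTangent 𝔥) =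
      -sigma (m : GenTangent 𝔥) (θ m' : GenTangent 𝔥)) :
    ∃ Λ ∈ ⋀[ℂ]^2 𝒥.L, 𝒥.contraction Λ = θ := by
  obtain ⟨Λ, hΛ, h⟩ := exists_bivector_contractLeft (K := ℂ)
    (θ ∘ₗ 𝒥.conjEquivDual.symm.toLinearMap) (fun d d' => by
      obtain ⟨m, rfl⟩ := 𝒥.conjEquivDual.surjective d
      obtain ⟨m', rfl⟩ := 𝒥.conjEquivDual.surjective d'
      simp only [LinearMap.comp_apply, LinearEquiv.coe_coe, LinearEquiv.symm_apply_apply]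
      exact hθ m' m)
  refine ⟨Λ, hΛ, LinearMap.ext fun m => ?_⟩
  change ExteriorAlgebra.ιInv (CliffordAlgebra.contractLeft (𝒥.conjEquivDual m) Λ) = θ m
  rw [h, ExteriorAlgebra.ι_leftInverse]
  simp

theorem contraction_smul (c : ℂ) (Γ : ExteriorAlgebra ℂ 𝒥.L) :
    𝒥.contraction (c • Γ) = c • 𝒥.contraction Γ := by
  refine LinearMap.ext fun m => ?_
  change ExteriorAlgebra.ιInv (CliffordAlgebra.contractLeft (𝒥.conjEquivDual m) (c • Γ)) =
    c • ExteriorAlgebra.ιInv (CliffordAlgebra.contractLeft (𝒥.conjEquivDual m) Γ)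
  rw [map_smul, map_smul]

theorem mem_deform (Γ : ExteriorAlgebra ℂ 𝒥.L) (a : GenTangent 𝔥) :
    a ∈ 𝒥.deform Γ ↔ ∃ m : conjSub 𝒥.L,
      (m : GenTangent 𝔥) + (𝒥.contraction Γ m : GenTangent 𝔥) = conjE a := Iff.rfl

end GenComplex

/-! ### The deformation from a complex to a symplectic structure. -/

section Deformation

variable {𝔥 : Type*} [LieRing 𝔥] [LieAlgebra ℝ 𝔥]

theorem conjD_baseChange (Ω : LinearMap.BilinForm ℝ 𝔥) (X : ℂ ⊗[ℝ] 𝔥) :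
    conjD (Ω.baseChange ℂ X) = Ω.baseChange ℂ (conjV X) := by
  refine LinearMap.ext fun Z => ?_
  have := baseChange_conj Ω X (conjV Z)
  rw [conjV_conjV] at this
  rw [conjD_apply, this]

variable {J : 𝔥 →ₗ[ℝ] 𝔥} {Ω Ω' : LinearMap.BilinForm ℝ 𝔥}

theorem baseChange_comp_eq (h : ∀ x y, Ω' x y = Ω (J x) y) (X Y : ℂ ⊗[ℝ] 𝔥) :
    Ω'.baseChange ℂ X Y = Ω.baseChange ℂ (J.baseChange ℂ X) Y := by
  have : Ω'.baseChange ℂ = Ω.baseChange ℂ ∘ₗ J.baseChange ℂ :=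
    complexification_ext₂ fun x y => by simp [h]
  rw [this]; rfl

/-- Since `Ω` and `Ω(J-, -)` are both alternating, `J` is self-adjoint for `Ω`. Consequently its
eigenspaces for `i` and `-i` are `Ω`-orthogonal, so `Ω` maps `(0,1)`-vectors to `(0,1)`-forms. -/
theorem baseChange_comp_comm (hΩ : Ω.IsAlt) (hΩ' : Ω'.IsAlt) (h : ∀ x y, Ω' x y = Ω (J x) y)
    (X Y : ℂ ⊗[ℝ] 𝔥) :
    Ω.baseChange ℂ (J.baseChange ℂ X) Y = Ω.baseChange ℂ X (J.baseChange ℂ Y) := by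
  rw [← baseChange_comp_eq h, baseChange_alt hΩ', baseChange_alt hΩ X, baseChange_comp_eq h]

theorem add_smul_baseChange_mem_T10 (hJ : ∀ x, J (J x) = -x) (X : ℂ ⊗[ℝ] 𝔥) :
    J.baseChange ℂ X + Complex.I • X ∈ T10 J := by
  rw [mem_T10, map_add, map_smul, baseChange_sq hJ, smul_add, smul_smul, Complex.I_mul_I]
  module

theorem IsClosedForm.smul {B : LinearMap.BilinForm ℝ 𝔥} (hB : IsClosedForm B) (c : ℝ) :
    IsClosedForm (c • B) := fun x y z => by
  simp only [LinearMap.smul_apply, ← smul_add, hB x y z, smul_zero]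

theorem IsSymplectic.smul (hΩ : IsSymplectic Ω) {c : ℝ} (hc : c ≠ 0) : IsSymplectic (c • Ω) where
  isAlt x := by simp [hΩ.isAlt x]
  nondegenerate := by
    refine ⟨fun x hx => hΩ.nondegenerate.1 x fun y => ?_,
      fun y hy => hΩ.nondegenerate.2 y fun x => ?_⟩
    · exact (smul_eq_zero.1 (hx y)).resolve_left hc
    · exact (smul_eq_zero.1 (hy x)).resolve_left hc
  closed := hΩ.closed.smul c

theorem baseChange_smul (c : ℝ) (X : ℂ ⊗[ℝ] 𝔥) :
    (c • Ω).baseChange ℂ X = (c : ℂ) • Ω.baseChange ℂ X := by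
  have : (c • Ω).baseChange ℂ = (c : ℂ) • Ω.baseChange ℂ :=
    complexification_ext₂ fun x y => by simp
  rw [this]; rfl

/-- The form `ι_W Ω` is of type `(0,1)` exactly if `W` is of type `(0,1)`. -/
theorem baseChange_mem_dualAnnihilator_iff (hJ : ∀ x, J (J x) = -x) (hΩ : IsSymplectic Ω)
    (hΩ' : Ω'.IsAlt) (h : ∀ x y, Ω' x y = Ω (J x) y) (W : ℂ ⊗[ℝ] 𝔥) :
    Ω.baseChange ℂ W ∈ (T10 J).dualAnnihilator ↔ J.baseChange ℂ W = -(Complex.I • W) := by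
  rw [Submodule.mem_dualAnnihilator]
  constructor
  · intro hW
    refine baseChange_injective hΩ.nondegenerate (LinearMap.ext fun Y => ?_)
    have h1 := hW _ (add_smul_baseChange_mem_T10 hJ Y)
    rw [map_add, map_smul, ← baseChange_comp_comm hΩ.isAlt hΩ' h] at h1
    simp only [map_neg, map_smul, LinearMap.neg_apply, LinearMap.smul_apply]
    exact eq_neg_of_add_eq_zero_left h1
  · intro hW Y hY
    have h1 := baseChange_comp_comm hΩ.isAlt hΩ' h W Y
    rw [hW, mem_T10.1 hY] at h1
    simp only [map_neg, map_smul, LinearMap.neg_apply, LinearMap.smul_apply, smul_eq_mul] at h1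
    have h2 : (2 * Complex.I) * Ω.baseChange ℂ W Y = 0 := by linear_combination -h1
    exact (mul_eq_zero.1 h2).resolve_left (by simp)

variable [FiniteDimensional ℝ 𝔥]

/-- The complexified musical isomorphism `X ↦ ι_X Ω` of a non-degenerate form. -/
def cxFlat {Ω : LinearMap.BilinForm ℝ 𝔥} (hΩ : Ω.Nondegenerate) :
    (ℂ ⊗[ℝ] 𝔥) ≃ₗ[ℂ] Module.Dual ℂ (ℂ ⊗[ℝ] 𝔥) :=
  LinearEquiv.ofBijective (Ω.baseChange ℂ)
    ⟨baseChange_injective hΩ, (LinearMap.injective_iff_surjective_of_finrank_eq_finrank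
      (Subspace.dual_finrank_eq).symm).1 (baseChange_injective hΩ)⟩

theorem cxFlat_apply {Ω : LinearMap.BilinForm ℝ 𝔥} (hΩ : Ω.Nondegenerate) (X : ℂ ⊗[ℝ] 𝔥) :
    cxFlat hΩ X = Ω.baseChange ℂ X := rfl

/-- The bivector deforming a complex structure `J` to the symplectic form `Ω`, as a map from
`conj L` to `L`. -/
def bivectorMap (hJ : IsComplexStructure J) (hΩ : IsSymplectic Ω) (hΩ' : Ω'.IsAlt)
    (h : ∀ x y, Ω' x y = Ω (J x) y) :
    conjSub (ofComplex J hJ).L →ₗ[ℂ] (ofComplex J hJ).L :=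
  LinearMap.codRestrict (ofComplex J hJ).L
    ((LinearMap.inl ℂ (ℂ ⊗[ℝ] 𝔥) (Module.Dual ℂ (ℂ ⊗[ℝ] 𝔥))) ∘ₗ
      -- After conjugation the constant is `i/2`. On `(0,1)`-vectors `J - i` is multiplication by
      -- `-2i`, and `(i/2)(-2i) = 1`, so the deformed space is cut out by `Ω((J - i)Z, -) = tα` with
      -- no further constant.
      ((-(Complex.I / 2) : ℂ) • (cxFlat hΩ.nondegenerate).symm.toLinearMap) ∘ₗ
      LinearMap.snd ℂ _ _ ∘ₗ (conjSub (ofComplex J hJ).L).subtype) (by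
    intro m
    refine ⟨Submodule.smul_mem _ _ ?_, Submodule.zero_mem _⟩
    obtain ⟨W, hW⟩ := (cxFlat hΩ.nondegenerate).surjective (m : GenTangent 𝔥).2
    have h1 : conjD (m : GenTangent 𝔥).2 ∈ (T10 J).dualAnnihilator := m.2.2
    rw [← hW, cxFlat_apply, conjD_baseChange, baseChange_mem_dualAnnihilator_iff hJ.1 hΩ hΩ' h,
      baseChange_conjV] at h1
    change (cxFlat hΩ.nondegenerate).symm (m : GenTangent 𝔥).2 ∈ T10 J
    rw [← hW, LinearEquiv.symm_apply_apply, mem_T10]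
    have h2 := congrArg conjV h1
    simpa using h2)

theorem bivectorMap_apply (hJ : IsComplexStructure J) (hΩ : IsSymplectic Ω) (hΩ' : Ω'.IsAlt)
    (h : ∀ x y, Ω' x y = Ω (J x) y) (m : conjSub (ofComplex J hJ).L) :
    (bivectorMap hJ hΩ hΩ' h m : GenTangent 𝔥) =
      ((-(Complex.I / 2)) • (cxFlat hΩ.nondegenerate).symm (m : GenTangent 𝔥).2, 0) := rfl

/-- Describes the whole family by equations instead of as a graph. With `α = ι_W Ω`, the vector part
of an element of the graph is a `(1,0)`-vector plus `t(i/2)W`, and applying `J - i` leaves `tW`. -/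
theorem mem_deform_of_contraction_eq (hJ : IsComplexStructure J) (hΩ : IsSymplectic Ω)
    (hΩ' : Ω'.IsAlt) (h : ∀ x y, Ω' x y = Ω (J x) y) {Γ : ExteriorAlgebra ℂ (ofComplex J hJ).L}
    {t : ℝ} (hΓ : (ofComplex J hJ).contraction Γ = (t : ℂ) • bivectorMap hJ hΩ hΩ' h)
    (a : GenTangent 𝔥) :
    a ∈ (ofComplex J hJ).deform Γ ↔ a.2 ∈ (T10 J).dualAnnihilator ∧
      Ω'.baseChange ℂ a.1 - Complex.I • Ω.baseChange ℂ a.1 = (t : ℂ) • a.2 := by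
  have hsub : ∀ X, Ω'.baseChange ℂ X - Complex.I • Ω.baseChange ℂ X =
      Ω.baseChange ℂ (J.baseChange ℂ X - Complex.I • X) := by
    intro X
    refine LinearMap.ext fun Y => ?_
    simp [baseChange_comp_eq h]
  obtain ⟨Z, α⟩ := a
  obtain ⟨W, rfl⟩ := (cxFlat hΩ.nondegenerate).surjective α
  have hconj : conjE ((Z, cxFlat hΩ.nondegenerate W) : GenTangent 𝔥) =
      (conjV Z, cxFlat hΩ.nondegenerate (conjV W)) := by
    rw [conjE_apply, cxFlat_apply, cxFlat_apply, conjD_baseChange]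
  have hinj := baseChange_injective hΩ.nondegenerate
  rw [GenComplex.mem_deform, hΓ, hsub, hconj]
  dsimp only
  rw [cxFlat_apply, cxFlat_apply,
    baseChange_mem_dualAnnihilator_iff hJ.1 hΩ hΩ' h, ← map_smul, hinj.eq_iff]
  constructor
  · rintro ⟨m, hm⟩
    rw [LinearMap.smul_apply, Submodule.coe_smul, bivectorMap_apply,
      ← cxFlat_apply hΩ.nondegenerate] at hm
    have h1 := congrArg Prod.fst hm
    have h2 := congrArg Prod.snd hm
    simp only [Prod.snd_add, Prod.smul_snd, smul_zero, add_zero] at h2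
    simp only [Prod.fst_add, Prod.smul_fst, h2, LinearEquiv.symm_apply_apply] at h1
    have h3 : conjD (m : GenTangent 𝔥).2 ∈ (T10 J).dualAnnihilator := m.2.2
    have h4 : conjV (m : GenTangent 𝔥).1 ∈ T10 J := m.2.1
    rw [h2, cxFlat_apply, conjD_baseChange, conjV_conjV,
      baseChange_mem_dualAnnihilator_iff hJ.1 hΩ hΩ' h] at h3
    refine ⟨h3, ?_⟩
    have h5 := congrArg conjV h1
    simp only [map_add, map_smulₛₗ, conjV_conjV, Complex.conj_ofReal, map_neg, map_div₀,
      Complex.conj_I, map_ofNat] at h5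
    rw [mem_T10] at h4
    rw [← h5, map_add, h4, map_smul, map_smul, h3]
    match_scalars <;> [ring; (ring_nf; simp)]
  · rintro ⟨h1, h2⟩
    -- Subtracting `t(i/2)W`, the `(0,1)`-component of `Z`, leaves a `(1,0)`-vector, the conjugate
    -- of the vector part of the required `m`.
    refine ⟨⟨(conjV (Z - ((t : ℂ) * (Complex.I / 2)) • W),
      cxFlat hΩ.nondegenerate (conjV W)), ?_, ?_⟩, ?_⟩
    · change conjV (conjV _) ∈ T10 J
      rw [conjV_conjV, mem_T10, map_sub, map_smul, h1, eq_add_of_sub_eq h2]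
      match_scalars <;> [(ring_nf; simp; try ring); ring]
    · change conjD _ ∈ (T10 J).dualAnnihilator
      rw [cxFlat_apply, conjD_baseChange, conjV_conjV,
        baseChange_mem_dualAnnihilator_iff hJ.1 hΩ hΩ' h, h1]
    · rw [LinearMap.smul_apply, Submodule.coe_smul, bivectorMap_apply]
      ext1
      · simp only [Prod.fst_add, Prod.smul_fst, LinearEquiv.symm_apply_apply, map_sub, map_smulₛₗ,
          Complex.conj_ofReal, map_mul, map_div₀, Complex.conj_I, map_ofNat]
        module
      · simp [cxFlat_apply]

theorem mem_ofSymplectic (hΩ : IsSymplectic Ω) (a : GenTangent 𝔥) :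
    a ∈ (ofSymplectic Ω hΩ).L ↔ a.2 = -(Complex.I • Ω.baseChange ℂ a.1) := by
  constructor
  · rintro ⟨X, rfl⟩
    rfl
  · intro h
    exact ⟨a.1, Prod.ext rfl h.symm⟩

theorem mem_map_bField_ofSymplectic (hΩ : IsSymplectic Ω) (B : LinearMap.BilinForm ℝ 𝔥)
    (a : GenTangent 𝔥) :
    a ∈ (ofSymplectic Ω hΩ).L.map (bField B) ↔
      B.baseChange ℂ a.1 - Complex.I • Ω.baseChange ℂ a.1 = a.2 := by
  constructor
  · rintro ⟨b, hb, rfl⟩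
    rw [bField_apply, (mem_ofSymplectic hΩ b).1 hb, neg_add_eq_sub]
  · intro h
    refine ⟨(a.1, a.2 - B.baseChange ℂ a.1), (mem_ofSymplectic hΩ _).2 ?_, ?_⟩
    · rw [← h, sub_sub_cancel_left]
    · rw [bField_apply]; simp

/-- If `Ω` and `Ω(J-, -)` are both symplectic, then the complex structure `J` deforms to the
symplectic structure `Ω`, up to the `B`-field transformation by `Ω(J-, -)`. -/
theorem exists_deform_eq (hJ : IsComplexStructure J) (hΩ : IsSymplectic Ω)
    (hΩ' : IsSymplectic Ω') (h : ∀ x y, Ω' x y = Ω (J x) y) :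
    ∃ Λ ∈ ⋀[ℂ]^2 (ofComplex J hJ).L,
      (∀ t : ℝ, IsGenComplex ((ofComplex J hJ).deform ((t : ℂ) • Λ))) ∧
      (ofComplex J hJ).deform Λ = (ofSymplectic Ω hΩ).L.map (bField Ω') := by
  obtain ⟨Λ, hΛ, hθ⟩ := (ofComplex J hJ).exists_contraction_eq (bivectorMap hJ hΩ hΩ'.isAlt h) (by
    intro m m'
    obtain ⟨W, hW⟩ := (cxFlat hΩ.nondegenerate).surjective (m : GenTangent 𝔥).2
    obtain ⟨W', hW'⟩ := (cxFlat hΩ.nondegenerate).surjective (m' : GenTangent 𝔥).2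
    rw [bivectorMap_apply, bivectorMap_apply, sigma_apply, sigma_apply, ← hW, ← hW',
      LinearEquiv.symm_apply_apply, LinearEquiv.symm_apply_apply, cxFlat_apply, cxFlat_apply,
      map_smul, map_smul, baseChange_alt hΩ.isAlt W' W]
    simp)
  have hsmul : ∀ t : ℝ, (ofComplex J hJ).contraction ((t : ℂ) • Λ) =
      (t : ℂ) • bivectorMap hJ hΩ hΩ'.isAlt h := fun t => by
    rw [GenComplex.contraction_smul, hθ]
  -- For `t ≠ 0` the type condition on `α` is redundant: `tα = Ω((J - i)Z, -)` vanishes on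
  -- `(1,0)`-vectors by self-adjointness of `J`.
  have hmem : ∀ t : ℝ, t ≠ 0 → (ofComplex J hJ).deform ((t : ℂ) • Λ) =
      {a : GenTangent 𝔥 | Ω'.baseChange ℂ a.1 - Complex.I • Ω.baseChange ℂ a.1 =
        (t : ℂ) • a.2} := by
    intro t ht
    ext a
    rw [SetLike.mem_coe, mem_deform_of_contraction_eq hJ hΩ hΩ'.isAlt h (hsmul t), Set.mem_ofPred,
      and_iff_right_iff_imp]
    intro ha
    have hta : (t : ℂ) • a.2 ∈ (T10 J).dualAnnihilator := by
      rw [← ha, Submodule.mem_dualAnnihilator]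
      intro Y hY
      rw [LinearMap.sub_apply, LinearMap.smul_apply, baseChange_comp_eq h,
        baseChange_comp_comm hΩ.isAlt hΩ'.isAlt h, mem_T10.1 hY, map_smul, sub_self]
    exact (Submodule.smul_mem_iff _ (Complex.ofReal_ne_zero.2 ht)).1 hta
  refine ⟨Λ, hΛ, fun t => ?_, ?_⟩
  -- At `t = 0` the equation reads `JZ = iZ`, which gives back `L_J`. Otherwise dividing by `t`
  -- exhibits the transform of `t⁻¹Ω` by `t⁻¹Ω'`.
  · by_cases ht : t = 0
    · refine ⟨ofComplex J hJ, ?_⟩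
      ext a
      rw [mem_deform_of_contraction_eq hJ hΩ hΩ'.isAlt h (hsmul t), ht, Complex.ofReal_zero,
        zero_smul, and_comm]
      refine and_congr_left fun _ => ?_
      change a.1 ∈ T10 J ↔ _
      rw [mem_T10, ← sub_eq_zero, ← (baseChange_injective hΩ.nondegenerate).eq_iff, map_zero,
        map_sub, map_smul]
      have : Ω'.baseChange ℂ a.1 = Ω.baseChange ℂ (J.baseChange ℂ a.1) :=
        LinearMap.ext fun Y => baseChange_comp_eq h _ _
      rw [this]
    · refine ⟨(ofSymplectic _ (hΩ.smul (inv_ne_zero ht))).bTransform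
        (hΩ'.smul (inv_ne_zero ht)).isAlt (hΩ'.smul (inv_ne_zero ht)).closed, ?_⟩
      refine SetLike.coe_injective ?_
      rw [hmem t ht]
      ext a
      change a ∈ (ofSymplectic _ (hΩ.smul (inv_ne_zero ht))).L.map (bField (t⁻¹ • Ω')) ↔ _
      rw [mem_map_bField_ofSymplectic, baseChange_smul, baseChange_smul, smul_comm Complex.I,
        ← smul_sub, Set.mem_ofPred, Complex.ofReal_inv,
        inv_smul_eq_iff₀ (Complex.ofReal_ne_zero.2 ht)]
  · refine SetLike.coe_injective ?_
    have h1 := hmem 1 one_ne_zero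
    rw [Complex.ofReal_one, one_smul] at h1
    rw [h1]
    ext a
    rw [SetLike.mem_coe, mem_map_bField_ofSymplectic, Set.mem_ofPred, one_smul]

end Deformation

end

end GenGeom

/-! ### Fitting projections, and functionals invariant under the square of an endomorphism. -/

namespace GenGeom

/-- The Fitting decomposition of an endomorphism, as a projection. -/
theorem eventually_exists_fitting_projection {K V : Type*} [Field K] [AddCommGroup V] [Module K V]
    [FiniteDimensional K V] (f : Module.End K V) :
    ∀ᶠ n in Filter.atTop, ∃ p : Module.End K V, (∀ x, (f ^ n) (p x) = 0) ∧
      (∀ x, ∃ y, x - p x = (f ^ n) y) ∧ (∀ x, (f ^ n) x = 0 → p x = x) ∧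
      ∀ R : Module.End K V, Commute R f → Commute R p := by
  filter_upwards [f.eventually_isCompl_ker_pow_range_pow] with n hn
  refine ⟨Submodule.projection _ _ hn, Submodule.projection_apply_mem hn, fun x => ?_,
    fun x hx => Submodule.projection_apply_of_mem_left hn hx, fun R hR => ?_⟩
  · obtain ⟨y, hy⟩ := Submodule.sub_projection_mem hn x
    exact ⟨y, hy.symm⟩
  · have hRn : ∀ x, R ((f ^ n) x) = (f ^ n) (R x) := LinearMap.congr_fun (hR.pow_right n).eq
    refine LinearMap.ext fun x => ?_
    rw [Module.End.mul_apply, Module.End.mul_apply]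
    have h1 : R (Submodule.projection _ _ hn x) ∈ LinearMap.ker (f ^ n) := by
      rw [LinearMap.mem_ker, ← hRn, Submodule.projection_apply_mem hn x, map_zero]
    have h2 : R (x - Submodule.projection _ _ hn x) ∈ LinearMap.range (f ^ n) := by
      obtain ⟨y, hy⟩ := Submodule.sub_projection_mem hn x
      exact ⟨R y, by rw [← hRn, hy]⟩
    have h3 := (Submodule.projection_apply_eq_zero_iff hn).2 h2
    rw [map_sub, map_sub, Submodule.projection_apply_of_mem_left hn h1, sub_eq_zero] at h3
    exact h3.symm

/-- A functional invariant under `T ^ 2` scales powers of `T ± 1`. -/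
theorem map_pow_add_smul {K V X : Type*} [Field K] [AddCommGroup V] [Module K V]
    [AddCommGroup X] [Module K X] {T : Module.End K V} {F : V →ₗ[K] X}
    (hF : ∀ x, F (T (T x)) = F x) {ε : K} (hε : ε * ε = 1) (k : ℕ) (x : V) :
    F (((T + ε • 1) ^ (k + 1)) x) = (2 * ε) ^ k • F ((T + ε • 1) x) := by
  induction k generalizing x with
  | zero => simp
  | succ k ih =>
    rw [pow_succ, Module.End.mul_apply, ih, pow_succ, mul_smul]
    congr 1
    simp only [LinearMap.add_apply, LinearMap.smul_apply, Module.End.one_apply, map_add, map_smul,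
      hF, smul_add, smul_smul, hε]
    rw [mul_assoc, hε]
    module

/-- For `n ≥ 1` the vector lies in the image of `(T - ε)(T + ε) = T² - 1`, which `F` kills. So `F ∘
T = εF` on the Fitting image of `T + ε`. -/
theorem map_sub_smul_pow_eq_zero {K V X : Type*} [Field K] [AddCommGroup V] [Module K V]
    [AddCommGroup X] [Module K X] {T : Module.End K V} {F : V →ₗ[K] X}
    (hF : ∀ x, F (T (T x)) = F x) {ε : K} (hε : ε * ε = 1) {n : ℕ} (hn : n ≠ 0) (x : V) :
    F (T (((T + ε • 1) ^ n) x) - ε • ((T + ε • 1) ^ n) x) = 0 := by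
  obtain ⟨k, rfl⟩ := Nat.exists_eq_succ_of_ne_zero hn
  rw [pow_succ', Module.End.mul_apply]
  simp only [LinearMap.add_apply, LinearMap.smul_apply, Module.End.one_apply, map_add, map_smul,
      hF, smul_add, smul_smul, hε, map_sub, one_smul]
  abel

/-- Modulo the kernel of `F`, `T` behaves as an involution, so a power of `T + ε` is a nonzero
multiple of `T + ε` there. This gives `F ∘ T = -εF` on the generalized eigenspace, although `T`
itself need not be semisimple on it. -/
theorem map_eq_zero_of_pow_add_smul {K V X : Type*} [Field K] [CharZero K] [AddCommGroup V]
    [Module K V] [AddCommGroup X] [Module K X] {T : Module.End K V} {F : V →ₗ[K] X}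
    (hF : ∀ x, F (T (T x)) = F x) {ε : K} (hε : ε * ε = 1) {n : ℕ} (hn : n ≠ 0) {x : V}
    (hx : ((T + ε • 1) ^ n) x = 0) : F (T x + ε • x) = 0 := by
  obtain ⟨k, rfl⟩ := Nat.exists_eq_succ_of_ne_zero hn
  have h := map_pow_add_smul hF hε k x
  rw [hx, map_zero] at h
  have hε0 : ε ≠ 0 := left_ne_zero_of_mul_eq_one hε
  exact (smul_eq_zero.1 h.symm).resolve_left (pow_ne_zero _ (mul_ne_zero two_ne_zero hε0))

/-- Moving powers of `T + c` across a form for which `T` is skew. -/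
theorem apply_pow_add_smul {K V : Type*} [Field K] [AddCommGroup V] [Module K V]
    {B : LinearMap.BilinForm K V} {T : Module.End K V} (hT : ∀ x y, B (T x) y = -B x (T y))
    (c : K) (n : ℕ) (x y : V) :
    B (((T + c • 1) ^ n) x) y = (-1) ^ n * B x (((T + (-c) • 1) ^ n) y) := by
  induction n generalizing x y with
  | zero => simp
  | succ n ih =>
    rw [pow_succ, Module.End.mul_apply, ih, pow_succ' (T + (-c) • 1), Module.End.mul_apply]
    simp only [LinearMap.add_apply, LinearMap.smul_apply, Module.End.one_apply, map_add, map_smul,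
      hT, smul_eq_mul, pow_succ]
    ring

/-! ### Splittings of the connection from the endomorphism `T`. -/

section Splitting

variable {𝔤 : Type*} [LieRing 𝔤] [LieAlgebra ℝ 𝔤]

/-- A projection `P` splits `γ` if the range `N` and the kernel `W` of `P` satisfy
`γ(N) N ⊆ W`, `γ(N) W = 0`, `γ(W) N ⊆ N`, `γ(W) W ⊆ W`, and `γ` is symmetric on `N`. -/
structure IsSplitting (γ : FlatConnection 𝔤) (P : 𝔤 →ₗ[ℝ] 𝔤) : Prop where
  proj : ∀ x, P (P x) = P x
  symm : ∀ x y, γ (P x) y = γ (P y) x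
  map_eq_zero : ∀ x y, P (γ (P x) y) = 0
  map_comm : ∀ x y, P (γ (x - P x) y) = γ (x - P x) (P y)

/-- `T` acts inside `γ` as `-1` on the range of `P` and as `1` on its kernel, so `γ(x - Tx) =
2γ(Px)` and the symmetry hypothesis becomes symmetry of `γ(Px)y`. -/
theorem IsSplitting.of_commute {γ : FlatConnection 𝔤} {T P : Module.End ℝ 𝔤}
    (hT : ∀ a b, T (γ a b) = γ (T a) (T b))
    (hsymm : ∀ x y, γ (x - T x) y = γ (y - T y) x)
    (hP : ∀ x, P (P x) = P x) (hcomm : ∀ R : Module.End ℝ 𝔤, Commute R T → Commute R P)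
    (h₁ : ∀ x, γ (T (P x) + P x) = 0) (h₂ : ∀ x, γ (T (x - P x) - (x - P x)) = 0)
    (hfix : ∀ x, T x = x → P x = 0) : IsSplitting γ P := by
  have hneg : ∀ x, γ (T (P x)) = -γ (P x) := fun x => by
    have := h₁ x
    rw [map_add] at this
    exact eq_neg_of_add_eq_zero_left this
  have hpos : ∀ x, γ (T (x - P x)) = γ (x - P x) := fun x => by
    have := h₂ x
    rw [map_sub] at this
    exact sub_eq_zero.1 this
  have hTP : ∀ x, P (T x) = T (P x) := fun x =>
    (LinearMap.congr_fun (hcomm T (Commute.refl T)).eq x).symm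
  have htwo : ∀ x, γ (x - T x) = (2 : ℝ) • γ (P x) := fun x => by
    have h := hpos x
    rw [map_sub, map_sub, map_sub, hneg] at h
    rw [map_sub, eq_add_of_sub_eq h]
    module
  have hS : ∀ x y, γ (P x) y = γ (P y) x := fun x y => by
    have h := hsymm x y
    rw [htwo, htwo, LinearMap.smul_apply, LinearMap.smul_apply] at h
    exact smul_right_injective _ (two_ne_zero (α := ℝ)) h
  refine ⟨hP, hS, fun x y => hfix _ ?_, fun x y => ?_⟩
  -- Two sign changes, one on each side of an application of symmetry, show that `T` fixes `γ(Px)y`;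
  -- then `hfix` applies.
  · rw [hT, hneg, LinearMap.neg_apply, hS x (T y), hTP, hneg, LinearMap.neg_apply, neg_neg, hS]
  -- As `T` is multiplicative for `γ` and invisible inside `γ` on the kernel of `P`, the operator
  -- `γ(x - Px)` commutes with `T`, hence with `P`.
  · have : Commute (γ (x - P x)) T := LinearMap.ext fun z => by
      rw [Module.End.mul_apply, Module.End.mul_apply, hT, hpos]
    exact (LinearMap.congr_fun (hcomm _ this).eq y).symm

variable [FiniteDimensional ℝ 𝔤]

/-- The two splittings given by the Fitting decompositions of `T + 1` and `T - 1`. -/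
theorem exists_isSplitting {γ : FlatConnection 𝔤} {T : Module.End ℝ 𝔤}
    {ω : LinearMap.BilinForm ℝ 𝔤}
    (hT : ∀ a b, T (γ a b) = γ (T a) (T b))
    (hsymm : ∀ x y, γ (x - T x) y = γ (y - T y) x)
    (hsq : ∀ x, γ (T (T x)) = γ x) (hω : ∀ x y, ω (T x) y = -ω x (T y)) :
    ∃ P Q : 𝔤 →ₗ[ℝ] 𝔤, IsSplitting γ P ∧ IsSplitting γ Q ∧
      (∀ x y, ω (x - P x) (y - Q y) = 0) ∧ ∀ x y, ω (P x) (Q y) = 0 := by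
  -- One exponent serves both decompositions, so that powers can be moved across `ω`. It must be
  -- nonzero because the lemmas on invariant functionals and the inclusion of eigenvectors in the
  -- kernels of the powers fail for `n = 0`.
  obtain ⟨n, ⟨p, hp1, hp2, hp3, hp4⟩, ⟨r, hr1, hr2, hr3, hr4⟩, hn⟩ :=
    ((eventually_exists_fitting_projection (T + (1 : ℝ) • 1)).and
      ((eventually_exists_fitting_projection (T + (-1 : ℝ) • 1)).and
        (Filter.eventually_ne_atTop 0))).exists
  have hc : ∀ (c : ℝ) (R : Module.End ℝ 𝔤), Commute R T → Commute R (T + c • 1) :=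
    fun c R h => h.add_right ((Commute.one_right R).smul_right c)
  have hsq' : ∀ x, γ.toLinearMap (T (T x)) = γ.toLinearMap x := hsq
  have hpp : ∀ x, p (p x) = p x := fun x => hp3 _ (hp1 x)
  have hrr : ∀ x, r (r x) = r x := fun x => hr3 _ (hr1 x)
  -- `p` projects onto the generalized eigenspace of `T` for `-1`, and `r` onto the one for `1`. For
  -- the second splitting the generalized eigenspace for `1` is the kernel, so `Q = 1 - r`.
  refine ⟨p, LinearMap.id - r, .of_commute hT hsymm hpp (fun R h => hp4 R (hc 1 R h)) ?_ ?_ ?_,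
    .of_commute hT hsymm ?_
      (fun R h => (Commute.one_right R).sub_right (hr4 R (hc (-1) R h))) ?_ ?_ ?_, ?_, ?_⟩
  · intro x
    simpa using map_eq_zero_of_pow_add_smul hsq' (by norm_num) hn (hp1 x)
  · intro x
    obtain ⟨y, hy⟩ := hp2 x
    have := map_sub_smul_pow_eq_zero hsq' (ε := (1 : ℝ)) (by norm_num) hn y
    rw [← hy] at this
    simpa using this
  · intro x hx
    have hTp : T (p x) = p x := by
      have := LinearMap.congr_fun (hp4 T (hc 1 T (Commute.refl T))).eq x
      rw [Module.End.mul_apply, Module.End.mul_apply, hx] at this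
      exact this
    -- `T` fixes `p x`, so `(T + 1)^n` multiplies it by `2^n`; yet `p x` lies in the kernel of `(T +
    -- 1)^n`.
    have hk : ∀ k : ℕ, ((T + (1 : ℝ) • 1) ^ k) (p x) = (2 : ℝ) ^ k • p x := by
      intro k
      induction k with
      | zero => simp
      | succ k ih =>
        rw [pow_succ', Module.End.mul_apply, ih, map_smul, LinearMap.add_apply, hTp, pow_succ]
        simp only [one_smul, Module.End.one_apply]
        module
    have h0 := hk n
    rw [hp1] at h0
    exact (smul_eq_zero.1 h0.symm).resolve_left (by positivity)
  · intro x
    simp [hrr]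
  · intro x
    obtain ⟨y, hy⟩ := hr2 x
    have := map_sub_smul_pow_eq_zero hsq' (ε := (-1 : ℝ)) (by norm_num) hn y
    rw [← hy] at this
    rw [neg_smul, one_smul, sub_neg_eq_add] at this
    exact this
  · intro x
    have := map_eq_zero_of_pow_add_smul hsq' (ε := (-1 : ℝ)) (by norm_num) hn (hr1 x)
    simpa [sub_eq_add_neg] using this
  · intro x hx
    have h0 : ((T + (-1 : ℝ) • 1) ^ n) x = 0 := by
      obtain ⟨k, rfl⟩ := Nat.exists_eq_succ_of_ne_zero hn
      rw [pow_succ, Module.End.mul_apply]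
      simp [hx]
    simp [hr3 x h0]
  -- As `T` is skew for `ω`, the adjoint of `(T + 1)^n` is `±(T - 1)^n`. So the image of the first
  -- is orthogonal to the kernel of the second and, in the next case, the kernel of the first to the
  -- image of the second.
  · intro x y
    obtain ⟨z, hz⟩ := hp2 x
    change ω (x - p x) (y - (y - r y)) = 0
    rw [hz, apply_pow_add_smul hω, sub_sub_cancel, hr1, map_zero, mul_zero]
  · intro x y
    obtain ⟨z, hz⟩ := hr2 y
    have h := apply_pow_add_smul hω 1 n (p x) z
    rw [hp1, map_zero, LinearMap.zero_apply] at h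
    change ω (p x) (y - r y) = 0
    rw [hz]
    exact (mul_eq_zero.1 h.symm).resolve_left (pow_ne_zero _ (by norm_num))

end Splitting

/-! ### Automorphisms of the semi-direct product from splittings. -/

section SemiDirect

variable {𝔤 : Type*} [LieRing 𝔤] [LieAlgebra ℝ 𝔤] (γ : FlatConnection 𝔤)

/-- The endomorphism of `𝔤 ⋉_γ V` that is the identity on the kernel of `P` and the complex
structure `J` on the range of `P`. -/
noncomputable def splitMap (P : 𝔤 →ₗ[ℝ] 𝔤) : SemiProd γ →ₗ[ℝ] SemiProd γ :=
  LinearMap.prod (SemiProd.fst γ - P ∘ₗ SemiProd.fst γ - P ∘ₗ SemiProd.snd γ)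
    (SemiProd.snd γ - P ∘ₗ SemiProd.snd γ + P ∘ₗ SemiProd.fst γ)

theorem fst_splitMap (P : 𝔤 →ₗ[ℝ] 𝔤) (a : SemiProd γ) :
    SemiProd.fst γ (splitMap γ P a) =
      SemiProd.fst γ a - P (SemiProd.fst γ a) - P (SemiProd.snd γ a) := rfl

theorem snd_splitMap (P : 𝔤 →ₗ[ℝ] 𝔤) (a : SemiProd γ) :
    SemiProd.snd γ (splitMap γ P a) =
      SemiProd.snd γ a - P (SemiProd.snd γ a) + P (SemiProd.fst γ a) := rfl

variable {γ}

theorem splitMap_bijective {P : 𝔤 →ₗ[ℝ] 𝔤} (hP : ∀ x, P (P x) = P x) :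
    Function.Bijective (splitMap γ P) := by
  -- The fourth power is the identity, since `J` has order four on the range of `P`; the inverse is
  -- the cube.
  have h4 : ∀ a, splitMap γ P (splitMap γ P (splitMap γ P (splitMap γ P a))) = a := by
    intro a
    refine SemiProd.ext' ?_ ?_ <;>
    · simp only [fst_splitMap, snd_splitMap, map_sub, map_add, hP]
      abel
  exact ⟨Function.LeftInverse.injective (g := fun a => splitMap γ P (splitMap γ P
    (splitMap γ P a))) h4, fun a => ⟨_, h4 a⟩⟩

/-- Let `N` and `W` be the range and the kernel of `P`. Brackets within `N ⊕ N` land in `W ⊕ W`,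
where the map is the identity, and symmetry of `γ` on `N` makes them `J`-invariant. Brackets of `W ⊕
W` with `N ⊕ N` commute with `J` because `γ(N)W = 0`. The proof encodes this in the rules `hS` and
`hc`, which move `P` inside `γ`. -/
theorem splitMap_lie (hγ : IsTorsionFree γ) {P : 𝔤 →ₗ[ℝ] 𝔤} (hP : IsSplitting γ P)
    (a b : SemiProd γ) : splitMap γ P ⁅a, b⁆ = ⁅splitMap γ P a, splitMap γ P b⁆ := by
  have hS : ∀ x y, γ (P x) (P y) = γ (P x) y := fun x y => by
    rw [hP.symm, hP.proj, hP.symm]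
  have hc : ∀ x y, P (γ x y) = γ x (P y) - γ (P x) y := fun x y => by
    have := hP.map_comm x y
    rw [map_sub, LinearMap.sub_apply, LinearMap.sub_apply, map_sub, hP.map_eq_zero, sub_zero,
      hS] at this
    exact this
  set x := SemiProd.fst γ a with hx
  set u := SemiProd.snd γ a with hu
  set y := SemiProd.fst γ b with hy
  set v := SemiProd.snd γ b with hv
  refine SemiProd.ext' ?_ ?_
  · simp only [fst_splitMap, SemiProd.fst_lie, SemiProd.snd_lie, ← hx, ← hy, ← hu,
      ← hv, ← hγ _ _, map_sub, hc, LinearMap.sub_apply, hS]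
    rw [hP.symm y x, hP.symm v u, hP.symm v x, hP.symm y u]
    abel
  · simp only [fst_splitMap, snd_splitMap, SemiProd.fst_lie, SemiProd.snd_lie, ← hx, ← hy, ← hu,
      ← hv, ← hγ _ _, map_sub, map_add, hc, LinearMap.sub_apply, hS]
    rw [hP.symm y x, hP.symm v u, hP.symm v x, hP.symm y u]
    abel

/-- By `h₁` and `h₂` only kernel-range and range-kernel pairs contribute to `ω`. On such pairs
exactly one argument is hit by `J`, and `Ω₂(Ja, b) = Ω₂(a, Jb) = Ω₁(a, b)`. -/
theorem Ω₂_splitMap {ω : LinearMap.BilinForm ℝ 𝔤} {P Q : 𝔤 →ₗ[ℝ] 𝔤}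
    (h₁ : ∀ x y, ω (x - P x) (y - Q y) = 0) (h₂ : ∀ x y, ω (P x) (Q y) = 0) (a b : SemiProd γ) :
    SemiProd.Ω₂ γ ω (splitMap γ P a) (splitMap γ Q b) = SemiProd.Ω₁ γ ω a b := by
  have h3 : ∀ x y, ω x y = ω x (Q y) + ω (P x) y := fun x y => by
    have := h₁ x y
    simp only [map_sub, LinearMap.sub_apply, h₂] at this
    linear_combination this
  have h4 : ∀ a b : SemiProd γ, SemiProd.Ω₂ γ ω a b =
      ω (SemiProd.fst γ a) (SemiProd.fst γ b) - ω (SemiProd.snd γ a) (SemiProd.snd γ b) :=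
    fun _ _ => rfl
  have h5 : SemiProd.Ω₁ γ ω a b =
      -ω (SemiProd.fst γ a) (SemiProd.snd γ b) - ω (SemiProd.snd γ a) (SemiProd.fst γ b) := rfl
  rw [h4, h5]
  simp only [fst_splitMap, snd_splitMap, map_sub, map_add, LinearMap.sub_apply,
    LinearMap.add_apply, h₂]
  linear_combination h3 (SemiProd.fst γ a) (SemiProd.fst γ b) +
    h3 (SemiProd.fst γ a) (SemiProd.snd γ b) + h3 (SemiProd.snd γ a) (SemiProd.fst γ b) -
    h3 (SemiProd.snd γ a) (SemiProd.snd γ b)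

end SemiDirect

end GenGeom

namespace GenGeom

noncomputable section

/-! ### The complex structure, the three symplectic forms and the metric on the semi-direct product.
-/

section Structures

variable {𝔤 : Type*} [LieRing 𝔤] [LieAlgebra ℝ 𝔤] {γ : FlatConnection 𝔤}
  {ω : LinearMap.BilinForm ℝ 𝔤}

theorem SemiProd.fst_J (a : SemiProd γ) :
    SemiProd.fst γ (SemiProd.J γ a) = -SemiProd.snd γ a := rfl

theorem SemiProd.snd_J (a : SemiProd γ) :
    SemiProd.snd γ (SemiProd.J γ a) = SemiProd.fst γ a := rfl

theorem SemiProd.Ω₁_apply (a b : SemiProd γ) : SemiProd.Ω₁ γ ω a b =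
    -ω (SemiProd.fst γ a) (SemiProd.snd γ b) - ω (SemiProd.snd γ a) (SemiProd.fst γ b) := rfl

theorem SemiProd.Ω₂_apply (a b : SemiProd γ) : SemiProd.Ω₂ γ ω a b =
    ω (SemiProd.fst γ a) (SemiProd.fst γ b) - ω (SemiProd.snd γ a) (SemiProd.snd γ b) := rfl

theorem SemiProd.Ω₃_apply (a b : SemiProd γ) : SemiProd.Ω₃ γ ω a b =
    ω (SemiProd.fst γ a) (SemiProd.fst γ b) + ω (SemiProd.snd γ a) (SemiProd.snd γ b) := rfl

theorem SemiProd.Δ_apply (g : LinearMap.BilinForm ℝ 𝔤) (a b : SemiProd γ) : SemiProd.Δ γ g a b =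
    g (SemiProd.fst γ a) (SemiProd.fst γ b) + g (SemiProd.snd γ a) (SemiProd.snd γ b) := rfl

theorem isComplexStructure_J (hγ : IsTorsionFree γ) : IsComplexStructure (SemiProd.J γ) := by
  refine ⟨fun x => SemiProd.ext' ?_ ?_, fun x y => SemiProd.ext' ?_ ?_⟩
  · rfl
  · rfl
  · simp only [SemiProd.fst_J, SemiProd.snd_J, SemiProd.fst_lie, SemiProd.snd_lie, map_sub,
      ← hγ _ _, map_neg, LinearMap.neg_apply, map_zero]
    abel
  · simp only [SemiProd.fst_J, SemiProd.snd_J, SemiProd.fst_lie, SemiProd.snd_lie, map_sub,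
      ← hγ _ _, map_neg, LinearMap.neg_apply, map_zero]
    abel

theorem isSymplectic_Ω₁ (hω : IsSymplectic ω) (hγ : IsTorsionFree γ)
    (hγω : IsSymplecticConnection γ ω) : IsSymplectic (SemiProd.Ω₁ γ ω) where
  isAlt a := by
    rw [SemiProd.Ω₁_apply, ← hω.isAlt.neg_eq]
    ring
  nondegenerate := by
    refine ⟨fun a ha => SemiProd.ext' (hω.nondegenerate.1 _ fun y => ?_)
      (hω.nondegenerate.1 _ fun y => ?_), fun a ha => SemiProd.ext' (hω.nondegenerate.2 _ fun y => ?_)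
      (hω.nondegenerate.2 _ fun y => ?_)⟩
    · simpa [SemiProd.Ω₁_apply] using ha (SemiProd.mk γ 0 y)
    · simpa [SemiProd.Ω₁_apply] using ha (SemiProd.mk γ y 0)
    · simpa [SemiProd.Ω₁_apply] using ha (SemiProd.mk γ 0 y)
    · simpa [SemiProd.Ω₁_apply] using ha (SemiProd.mk γ y 0)
  closed a b c := by
    -- `Ω₁` pairs `𝔤` with `V` only, so closedness splits into three instances of this identity,
    -- each with a single vertical argument. It combines torsion-freeness with two uses of the
    -- symplectic condition.
    have key : ∀ x y w, -ω ⁅x, y⁆ w - ω (γ y w) x + ω (γ x w) y = 0 := fun x y w => by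
      rw [← hγ, map_sub, LinearMap.sub_apply]
      have h1 := hω.isAlt.neg_eq (γ y w) x
      have h2 := hω.isAlt.neg_eq (γ x w) y
      linear_combination h1 - h2 - hγω x y w + hγω y x w
    simp only [SemiProd.Ω₁_apply, SemiProd.fst_lie, SemiProd.snd_lie, map_sub,
      LinearMap.sub_apply]
    linear_combination key (SemiProd.fst γ a) (SemiProd.fst γ b) (SemiProd.snd γ c) +
      key (SemiProd.fst γ b) (SemiProd.fst γ c) (SemiProd.snd γ a) +
      key (SemiProd.fst γ c) (SemiProd.fst γ a) (SemiProd.snd γ b)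

/-- The form `(v, w) ↦ ω(γ(x)v, w)` is symmetric, so the terms cancel in pairs. As the vertical part
of `ω` is closed by itself, `Ω₂` and `Ω₃` are closed whatever sign it carries. -/
theorem symplecticConnection_cyclic (hω : IsSymplectic ω) (hγω : IsSymplecticConnection γ ω)
    (a b c : SemiProd γ) :
    ω (SemiProd.snd γ ⁅a, b⁆) (SemiProd.snd γ c) + ω (SemiProd.snd γ ⁅b, c⁆) (SemiProd.snd γ a) +
      ω (SemiProd.snd γ ⁅c, a⁆) (SemiProd.snd γ b) = 0 := by
  have key : ∀ x v w, ω (γ x v) w - ω (γ x w) v = 0 := fun x v w => by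
    have h1 := hω.isAlt.neg_eq v (γ x w)
    linear_combination hγω x v w + h1
  simp only [SemiProd.snd_lie, map_sub, LinearMap.sub_apply]
  linear_combination key (SemiProd.fst γ a) (SemiProd.snd γ b) (SemiProd.snd γ c) +
    key (SemiProd.fst γ b) (SemiProd.snd γ c) (SemiProd.snd γ a) +
    key (SemiProd.fst γ c) (SemiProd.snd γ a) (SemiProd.snd γ b)

theorem isSymplectic_Ω₂ (hω : IsSymplectic ω) (hγω : IsSymplecticConnection γ ω) :
    IsSymplectic (SemiProd.Ω₂ γ ω) where
  isAlt a := by rw [SemiProd.Ω₂_apply, hω.isAlt, hω.isAlt, sub_zero]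
  nondegenerate := by
    refine ⟨fun a ha => SemiProd.ext' (hω.nondegenerate.1 _ fun y => ?_)
      (hω.nondegenerate.1 _ fun y => ?_), fun a ha => SemiProd.ext' (hω.nondegenerate.2 _ fun y => ?_)
      (hω.nondegenerate.2 _ fun y => ?_)⟩
    · simpa [SemiProd.Ω₂_apply] using ha (SemiProd.mk γ y 0)
    · simpa [SemiProd.Ω₂_apply] using ha (SemiProd.mk γ 0 y)
    · simpa [SemiProd.Ω₂_apply] using ha (SemiProd.mk γ y 0)
    · simpa [SemiProd.Ω₂_apply] using ha (SemiProd.mk γ 0 y)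
  closed a b c := by
    simp only [SemiProd.Ω₂_apply, SemiProd.fst_lie]
    linear_combination hω.closed (SemiProd.fst γ a) (SemiProd.fst γ b) (SemiProd.fst γ c) -
      symplecticConnection_cyclic hω hγω a b c

theorem isSymplectic_Ω₃ (hω : IsSymplectic ω) (hγω : IsSymplecticConnection γ ω) :
    IsSymplectic (SemiProd.Ω₃ γ ω) where
  isAlt a := by rw [SemiProd.Ω₃_apply, hω.isAlt, hω.isAlt, add_zero]
  nondegenerate := by
    refine ⟨fun a ha => SemiProd.ext' (hω.nondegenerate.1 _ fun y => ?_)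
      (hω.nondegenerate.1 _ fun y => ?_), fun a ha => SemiProd.ext' (hω.nondegenerate.2 _ fun y => ?_)
      (hω.nondegenerate.2 _ fun y => ?_)⟩
    · simpa [SemiProd.Ω₃_apply] using ha (SemiProd.mk γ y 0)
    · simpa [SemiProd.Ω₃_apply] using ha (SemiProd.mk γ 0 y)
    · simpa [SemiProd.Ω₃_apply] using ha (SemiProd.mk γ y 0)
    · simpa [SemiProd.Ω₃_apply] using ha (SemiProd.mk γ 0 y)
  closed a b c := by
    simp only [SemiProd.Ω₃_apply, SemiProd.fst_lie]
    linear_combination hω.closed (SemiProd.fst γ a) (SemiProd.fst γ b) (SemiProd.fst γ c) +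
      symplecticConnection_cyclic hω hγω a b c

theorem isPseudoMetric_Δ {g : LinearMap.BilinForm ℝ 𝔤} (hg : IsPseudoMetric g) :
    IsPseudoMetric (SemiProd.Δ γ g) where
  isSymm := ⟨fun a b => by
    rw [SemiProd.Δ_apply, SemiProd.Δ_apply, hg.isSymm.eq (SemiProd.fst γ a) (SemiProd.fst γ b),
      hg.isSymm.eq (SemiProd.snd γ a) (SemiProd.snd γ b)]⟩
  nondegenerate := by
    refine ⟨fun a ha => SemiProd.ext' (hg.nondegenerate.1 _ fun y => ?_)
      (hg.nondegenerate.1 _ fun y => ?_), fun a ha => SemiProd.ext' (hg.nondegenerate.2 _ fun y => ?_)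
      (hg.nondegenerate.2 _ fun y => ?_)⟩
    · simpa [SemiProd.Δ_apply] using ha (SemiProd.mk γ y 0)
    · simpa [SemiProd.Δ_apply] using ha (SemiProd.mk γ 0 y)
    · simpa [SemiProd.Δ_apply] using ha (SemiProd.mk γ y 0)
    · simpa [SemiProd.Δ_apply] using ha (SemiProd.mk γ 0 y)

theorem Ω₁_eq_Ω₂_J (a b : SemiProd γ) :
    SemiProd.Ω₁ γ ω a b = SemiProd.Ω₂ γ ω (SemiProd.J γ a) b := by
  rw [SemiProd.Ω₁_apply, SemiProd.Ω₂_apply, SemiProd.fst_J, SemiProd.snd_J, map_neg,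
    LinearMap.neg_apply]
  ring

end Structures

/-! ### Properties of the endomorphism `T = g⁻¹ω` under the pseudo-Kähler hypothesis. -/

section InvComp

variable {𝔤 : Type*} [LieRing 𝔤] [LieAlgebra ℝ 𝔤] [FiniteDimensional ℝ 𝔤]
  {γ : FlatConnection 𝔤} {ω g : LinearMap.BilinForm ℝ 𝔤}

theorem apply_invComp (hg : g.Nondegenerate) (a b : 𝔤) : g (invComp g hg ω a) b = ω a b :=
  LinearMap.BilinForm.apply_toDual_symm_apply (hB := hg) (ω a) b

theorem skew_invComp (hω : ω.IsAlt) (hg : IsPseudoMetric g) (a b : 𝔤) :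
    ω (invComp g hg.nondegenerate ω a) b = -ω a (invComp g hg.nondegenerate ω b) := by
  have h1 := apply_invComp (ω := ω) hg.nondegenerate a (invComp g hg.nondegenerate ω b)
  have h2 := apply_invComp (ω := ω) hg.nondegenerate b (invComp g hg.nondegenerate ω a)
  rw [← h1, hg.isSymm.eq, h2, hω.neg_eq]

/-- If `g⁻¹ω` intertwines `γ`, then `γ ∘ g⁻¹ω` is the dual of `γ` with respect to `g`. -/
theorem metric_dual_connection (hω : IsSymplectic ω) (hg : IsPseudoMetric g)
    (hγω : IsSymplecticConnection γ ω)
    (hT : ∀ a b, invComp g hg.nondegenerate ω (γ a b) =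
      γ (invComp g hg.nondegenerate ω a) (invComp g hg.nondegenerate ω b)) (x a b : 𝔤) :
    g (γ (invComp g hg.nondegenerate ω x) a) b = -g a (γ x b) := by
  have hinj : Function.Injective (invComp g hg.nondegenerate ω) := by
    rw [injective_iff_map_eq_zero]
    intro y hy
    refine hω.nondegenerate.1 y fun z => ?_
    rw [← apply_invComp hg.nondegenerate, hy, map_zero, LinearMap.zero_apply]
  -- Writing `a = Ta'`, multiplicativity of `T` turns both sides into values of `ω`, where the
  -- connection is skew.
  obtain ⟨a, rfl⟩ := LinearMap.surjective_of_injective hinj a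
  rw [← hT, apply_invComp, apply_invComp]
  linear_combination hγω x a b

/-- `γ(Tx)` is minus the `g`-adjoint of `γ(x)`, and taking minus the adjoint twice is the identity.
-/
theorem connection_invComp_sq (hω : IsSymplectic ω) (hg : IsPseudoMetric g)
    (hγω : IsSymplecticConnection γ ω)
    (hT : ∀ a b, invComp g hg.nondegenerate ω (γ a b) =
      γ (invComp g hg.nondegenerate ω a) (invComp g hg.nondegenerate ω b)) (x : 𝔤) :
    γ (invComp g hg.nondegenerate ω (invComp g hg.nondegenerate ω x)) = γ x := by
  refine LinearMap.ext fun a => ?_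
  rw [← sub_eq_zero]
  refine hg.nondegenerate.1 _ fun b => ?_
  rw [map_sub, LinearMap.sub_apply, metric_dual_connection hω hg hγω hT, hg.isSymm.eq a,
    metric_dual_connection hω hg hγω hT, hg.isSymm.eq b]
  ring

theorem connection_sub_invComp_symm (hω : IsSymplectic ω) (hg : IsPseudoMetric g)
    (hγ : IsTorsionFree γ) (hγω : IsSymplecticConnection γ ω)
    (hT : ∀ a b, invComp g hg.nondegenerate ω (γ a b) =
      γ (invComp g hg.nondegenerate ω a) (invComp g hg.nondegenerate ω b))
    (hcl : IsClosedForm (SemiProd.Δ γ g ∘ₗ SemiProd.J γ)) (x y : 𝔤) :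
    γ (x - invComp g hg.nondegenerate ω x) y = γ (y - invComp g hg.nondegenerate ω y) x := by
  rw [← sub_eq_zero]
  refine hg.nondegenerate.1 _ fun w => ?_
  -- Two horizontal vectors and one vertical vector yield `g([x, y], w) - g(γ(y)w, x) + g(γ(x)w, y)
  -- = 0`. Passing to adjoints frees `w`.
  have h := hcl (SemiProd.mk γ x 0) (SemiProd.mk γ y 0) (SemiProd.mk γ 0 w)
  simp only [LinearMap.comp_apply, SemiProd.Δ_apply, SemiProd.fst_J, SemiProd.snd_J,
    SemiProd.fst_lie, SemiProd.snd_lie, SemiProd.fst_mk, SemiProd.snd_mk, map_zero, map_neg,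
    LinearMap.neg_apply, LinearMap.zero_apply, lie_zero, zero_lie, ← hγ x y, map_sub,
    LinearMap.sub_apply] at h
  have h1 := metric_dual_connection hω hg hγω hT x y w
  have h2 := metric_dual_connection hω hg hγω hT y x w
  have h3 := hg.isSymm.eq (γ x w) y
  have h4 := hg.isSymm.eq (γ y w) x
  simp only [map_sub, LinearMap.sub_apply]
  linear_combination h - h1 + h2 + h4 - h3

end InvComp

/-! ### Identifying `L` with the complexified Lie algebra, and comparing pairings. -/

section Parametrization

variable {𝔥 : Type*} [LieRing 𝔥] [LieAlgebra ℝ 𝔥]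

theorem baseChange_lie {A : 𝔥 →ₗ[ℝ] 𝔥} (hA : ∀ x y, A ⁅x, y⁆ = ⁅A x, A y⁆)
    (X Y : ℂ ⊗[ℝ] 𝔥) : A.baseChange ℂ ⁅X, Y⁆ = ⁅A.baseChange ℂ X, A.baseChange ℂ Y⁆ := by
  have : cxBracket.compr₂ (A.baseChange ℂ) =
      cxBracket.compl₁₂ (A.baseChange ℂ) (A.baseChange ℂ) :=
    complexification_ext₂ fun x y => by
      simp [cxBracket_apply, LieAlgebra.ExtendScalars.bracket_tmul, hA]
  exact LinearMap.congr_fun₂ this X Y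

variable [FiniteDimensional ℝ 𝔥]

/-- Two generalized complex structures whose Lie algebras `L` are both identified with the
complexification of `𝔥` have isomorphic differential Gerstenhaber algebras if their Hermitian
pairings differ by automorphisms of `𝔥`. -/
theorem nonempty_dgaEquiv_of_parametrization {𝒥₁ 𝒥₂ : GenComplex 𝔥}
    (e₁ : (ℂ ⊗[ℝ] 𝔥) ≃ₗ[ℂ] 𝒥₁.L) (e₂ : (ℂ ⊗[ℝ] 𝔥) ≃ₗ[ℂ] 𝒥₂.L)
    (h₁ : ∀ X Y, e₁ ⁅X, Y⁆ = 𝒥₁.bracketL (e₁ X) (e₁ Y))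
    (h₂ : ∀ X Y, e₂ ⁅X, Y⁆ = 𝒥₂.bracketL (e₂ X) (e₂ Y))
    {Ω Ω' : LinearMap.BilinForm ℝ 𝔥} {c : ℂ}
    (hΩ' : ∀ X Y, sigma (conjE (e₁ X : GenTangent 𝔥)) (e₁ Y : GenTangent 𝔥) =
      c * Ω'.baseChange ℂ Y (conjV X))
    (hΩ : ∀ X Y, sigma (conjE (e₂ X : GenTangent 𝔥)) (e₂ Y : GenTangent 𝔥) =
      c * Ω.baseChange ℂ Y (conjV X))
    (A B : 𝔥 ≃ₗ[ℝ] 𝔥) (hA : ∀ x y, A ⁅x, y⁆ = ⁅A x, A y⁆) (hB : ∀ x y, B ⁅x, y⁆ = ⁅B x, B y⁆)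
    (hAB : ∀ x y, Ω (A x) (B y) = Ω' x y) : Nonempty (GenComplex.DGAEquiv 𝒥₁ 𝒥₂) := by
  have hlie : ∀ C : 𝔥 ≃ₗ[ℝ] 𝔥, (∀ x y, C ⁅x, y⁆ = ⁅C x, C y⁆) → ∀ x y,
      (e₁.symm ≪≫ₗ C.baseChange ℝ ℂ 𝔥 𝔥 ≪≫ₗ e₂) (𝒥₁.bracketL x y) =
        𝒥₂.bracketL ((e₁.symm ≪≫ₗ C.baseChange ℝ ℂ 𝔥 𝔥 ≪≫ₗ e₂) x)
          ((e₁.symm ≪≫ₗ C.baseChange ℝ ℂ 𝔥 𝔥 ≪≫ₗ e₂) y) := by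
    intro C hC x y
    obtain ⟨X, rfl⟩ := e₁.surjective x
    obtain ⟨Y, rfl⟩ := e₁.surjective y
    simp only [LinearEquiv.trans_apply, ← h₁, ← h₂, LinearEquiv.symm_apply_apply]
    exact congrArg e₂ (baseChange_lie (A := C.toLinearMap) hC X Y)
  -- `A` transports `L`, while `B`, being real and so commuting with conjugation, transports `conj
  -- L`. The relation between `Ω` and `Ω'` is exactly the duality required of the two.
  refine ⟨GenComplex.DGAEquiv.ofLieEquiv 𝒥₁ 𝒥₂ (e₁.symm ≪≫ₗ A.baseChange ℝ ℂ 𝔥 𝔥 ≪≫ₗ e₂)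
    (e₁.symm ≪≫ₗ B.baseChange ℝ ℂ 𝔥 𝔥 ≪≫ₗ e₂) (hlie A hA) (hlie B hB) fun x y => ?_⟩
  obtain ⟨X, rfl⟩ := e₁.surjective x
  obtain ⟨Y, rfl⟩ := e₁.surjective y
  simp only [LinearEquiv.trans_apply, LinearEquiv.symm_apply_apply]
  rw [hΩ, hΩ']
  have h3 : (Ω.baseChange ℂ).compl₁₂ (A.toLinearMap.baseChange ℂ) (B.toLinearMap.baseChange ℂ) =
      Ω'.baseChange ℂ := complexification_ext₂ fun x y => by simp [hAB]
  rw [← h3]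
  exact congrArg (fun Z => c * Ω.baseChange ℂ (A.toLinearMap.baseChange ℂ Y) Z)
    (baseChange_conjV B.toLinearMap X).symm

variable {Ω : LinearMap.BilinForm ℝ 𝔥}

/-- The parametrization `X ↦ X - i ι_X Ω` of the generalized complex structure of a symplectic
form. -/
def symplecticEquiv (hΩ : IsSymplectic Ω) : (ℂ ⊗[ℝ] 𝔥) ≃ₗ[ℂ] (ofSymplectic Ω hΩ).L :=
  LinearEquiv.ofInjective (LinearMap.prod (LinearMap.id : (ℂ ⊗[ℝ] 𝔥) →ₗ[ℂ] (ℂ ⊗[ℝ] 𝔥))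
      (-(Complex.I • Ω.baseChange ℂ))) fun _ _ h => congrArg Prod.fst h

theorem coe_symplecticEquiv (hΩ : IsSymplectic Ω) (X : ℂ ⊗[ℝ] 𝔥) :
    (symplecticEquiv hΩ X : GenTangent 𝔥) = (X, -(Complex.I • Ω.baseChange ℂ X)) := rfl

theorem symplecticEquiv_lie (hΩ : IsSymplectic Ω) (X Y : ℂ ⊗[ℝ] 𝔥) :
    symplecticEquiv hΩ ⁅X, Y⁆ =
      (ofSymplectic Ω hΩ).bracketL (symplecticEquiv hΩ X) (symplecticEquiv hΩ Y) := by
  refine Subtype.ext (Prod.ext rfl ?_)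
  exact ((mem_ofSymplectic hΩ _).1
    ((ofSymplectic Ω hΩ).bracketL (symplecticEquiv hΩ X) (symplecticEquiv hΩ Y)).2).symm

theorem sigma_symplecticEquiv (hΩ : IsSymplectic Ω) (X Y : ℂ ⊗[ℝ] 𝔥) :
    sigma (conjE (symplecticEquiv hΩ X : GenTangent 𝔥)) (symplecticEquiv hΩ Y : GenTangent 𝔥) =
      (-2 * Complex.I) * Ω.baseChange ℂ Y (conjV X) := by
  rw [coe_symplecticEquiv, coe_symplecticEquiv, conjE_apply, sigma_apply]
  dsimp only
  rw [map_neg, map_smulₛₗ, conjD_baseChange, Complex.conj_I]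
  simp only [LinearMap.neg_apply, LinearMap.smul_apply, smul_eq_mul]
  rw [baseChange_alt hΩ.isAlt (conjV X)]
  ring

end Parametrization

end

end GenGeom

namespace GenGeom

noncomputable section

/-- Two complex linear maps on a complexification agree if they agree on real vectors. -/
theorem complexification_ext {𝔥 X : Type*} [AddCommGroup 𝔥] [Module ℝ 𝔥] [AddCommGroup X]
    [Module ℂ X] {F G : (ℂ ⊗[ℝ] 𝔥) →ₗ[ℂ] X} (h : ∀ x, F (1 ⊗ₜ x) = G (1 ⊗ₜ x)) : F = G := by
  refine LinearMap.ext fun X => ?_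
  induction X with
  | zero => simp
  | add x x' hx hx' => simp [hx, hx']
  | tmul z v =>
    have : (z ⊗ₜ[ℝ] v : ℂ ⊗[ℝ] 𝔥) = z • ((1 : ℂ) ⊗ₜ[ℝ] v) := by
      rw [TensorProduct.smul_tmul', smul_eq_mul, mul_one]
    rw [this, map_smul, map_smul, h]

/-! ### The Lie algebra `L_J` as a complexified semi-direct product. -/

section ComplexParametrization

variable {𝔤 : Type*} [LieRing 𝔤] [LieAlgebra ℝ 𝔤] {γ : FlatConnection 𝔤}
  {ω : LinearMap.BilinForm ℝ 𝔤}

variable (γ) in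
/-- The projection `(x, u) ↦ (x, 0)`. -/
def horizontal : SemiProd γ →ₗ[ℝ] SemiProd γ :=
  LinearMap.prod (SemiProd.fst γ) (0 : SemiProd γ →ₗ[ℝ] 𝔤)

variable (γ) in
/-- The projection `(x, u) ↦ (0, u)`. -/
def vertical : SemiProd γ →ₗ[ℝ] SemiProd γ :=
  LinearMap.prod (0 : SemiProd γ →ₗ[ℝ] 𝔤) (SemiProd.snd γ)

theorem fst_horizontal (a : SemiProd γ) :
    SemiProd.fst γ (horizontal γ a) = SemiProd.fst γ a := rfl

theorem snd_horizontal (a : SemiProd γ) : SemiProd.snd γ (horizontal γ a) = 0 := rfl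

theorem fst_vertical (a : SemiProd γ) : SemiProd.fst γ (vertical γ a) = 0 := rfl

theorem snd_vertical (a : SemiProd γ) :
    SemiProd.snd γ (vertical γ a) = SemiProd.snd γ a := rfl

variable (γ ω) in
/-- The map that sends `(x, u)` to `(x, -i x) + i ι_{(u, 0)} Ω₂ - ι_{(0, u)} Ω₂`; it identifies the
complexification of `𝔤 ⋉_γ V` with `L_J`. -/
def complexMap : (ℂ ⊗[ℝ] SemiProd γ) →ₗ[ℂ] GenTangent (SemiProd γ) :=
  LinearMap.prod
    ((horizontal γ).baseChange ℂ - Complex.I • (SemiProd.J γ ∘ₗ horizontal γ).baseChange ℂ)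
    (-((SemiProd.Ω₂ γ ω).baseChange ℂ ∘ₗ
      ((vertical γ).baseChange ℂ + Complex.I • (SemiProd.J γ ∘ₗ vertical γ).baseChange ℂ)))

theorem complexMap_apply (X : ℂ ⊗[ℝ] SemiProd γ) : complexMap γ ω X =
    ((horizontal γ).baseChange ℂ X - Complex.I • (SemiProd.J γ).baseChange ℂ
        ((horizontal γ).baseChange ℂ X),
      -((SemiProd.Ω₂ γ ω).baseChange ℂ ((vertical γ).baseChange ℂ X +
        Complex.I • (SemiProd.J γ).baseChange ℂ ((vertical γ).baseChange ℂ X)))) := by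
  simp only [complexMap, LinearMap.baseChange_comp]
  rfl

theorem complexMap_tmul (a : SemiProd γ) : complexMap γ ω (1 ⊗ₜ a) =
    (1 ⊗ₜ horizontal γ a - Complex.I ⊗ₜ SemiProd.J γ (horizontal γ a),
      -((SemiProd.Ω₂ γ ω).baseChange ℂ (1 ⊗ₜ vertical γ a +
        Complex.I ⊗ₜ SemiProd.J γ (vertical γ a)))) := by
  rw [complexMap_apply]
  simp [TensorProduct.smul_tmul']

/-- Torsion-freeness makes `x ↦ (x, -ix)` a homomorphism from `𝔤_ℂ`. Forms commute with each other,
and the Lie derivative on them becomes `γ` because `ω` intertwines `γ` with its dual. -/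
theorem complexMap_lie (hγ : IsTorsionFree γ)
    (hγω : IsSymplecticConnection γ ω) (X Y : ℂ ⊗[ℝ] SemiProd γ) :
    complexMap γ ω ⁅X, Y⁆ = courant (complexMap γ ω X) (complexMap γ ω Y) := by
  have hswap : ∀ x v w, ω v (γ x w) = -ω (γ x v) w := fun x v w => by
    linear_combination hγω x v w
  have key : cxBracket.compr₂ (complexMap γ ω) =
      courantBilin.compl₁₂ (complexMap γ ω) (complexMap γ ω) := by
    refine complexification_ext₂ fun a b => ?_
    rw [LinearMap.compr₂_apply, LinearMap.compl₁₂_apply, cxBracket_apply, courantBilin_apply,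
      LieAlgebra.ExtendScalars.bracket_tmul, one_mul, complexMap_tmul, complexMap_tmul,
      complexMap_tmul]
    ext1
    · have h1 : ⁅horizontal γ a, horizontal γ b⁆ = horizontal γ ⁅a, b⁆ :=
        SemiProd.ext' rfl (by simp [snd_horizontal])
      have h2 : ⁅SemiProd.J γ (horizontal γ a), SemiProd.J γ (horizontal γ b)⁆ = 0 :=
        SemiProd.ext' (by simp [SemiProd.fst_J, snd_horizontal])
          (by simp [SemiProd.fst_J, snd_horizontal])
      have h3 : SemiProd.J γ (horizontal γ ⁅a, b⁆) =
          ⁅horizontal γ a, SemiProd.J γ (horizontal γ b)⁆ +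
            ⁅SemiProd.J γ (horizontal γ a), horizontal γ b⁆ :=
        SemiProd.ext' (by simp [SemiProd.fst_J, snd_horizontal])
          (by simp [SemiProd.fst_J, SemiProd.snd_J, fst_horizontal, snd_horizontal, ← hγ _ _,
            sub_eq_add_neg])
      simp only [courant, sub_eq_add_neg, cx_lie_add, cx_add_lie, ← TensorProduct.tmul_neg,
        LieAlgebra.ExtendScalars.bracket_tmul, lie_neg, neg_lie, neg_neg, h1, h2, h3, one_mul,
        mul_one, TensorProduct.tmul_zero, TensorProduct.tmul_add, neg_add]
      abel
    · refine complexification_ext fun c => ?_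
      simp only [courant, lieDer_apply, LinearMap.neg_apply, sub_eq_add_neg,
        cx_lie_add, cx_add_lie, ← TensorProduct.tmul_neg, neg_lie, map_add, LinearMap.add_apply,
        LieAlgebra.ExtendScalars.bracket_tmul, LinearMap.BilinForm.baseChange_tmul, one_mul,
        mul_one, Complex.real_smul, SemiProd.Ω₂_apply, SemiProd.fst_J, SemiProd.snd_J,
        fst_horizontal, snd_horizontal, fst_vertical, snd_vertical, SemiProd.fst_lie,
        SemiProd.snd_lie, map_neg, map_zero, LinearMap.zero_apply, ← hγ _ _, hswap]
      push_cast
      ring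
  exact LinearMap.congr_fun₂ key X Y

theorem sigma_complexMap (X Y : ℂ ⊗[ℝ] SemiProd γ) (hω : IsSymplectic ω) :
    sigma (conjE (complexMap γ ω X)) (complexMap γ ω Y) =
      (-2 * Complex.I) * (SemiProd.Ω₁ γ ω).baseChange ℂ Y (conjV X) := by
  have h1 : ∀ X, conjE (complexMap γ ω X) =
      ((horizontal γ).baseChange ℂ (conjV X) + Complex.I • (SemiProd.J γ).baseChange ℂ
        ((horizontal γ).baseChange ℂ (conjV X)),
      -((SemiProd.Ω₂ γ ω).baseChange ℂ ((vertical γ).baseChange ℂ (conjV X) -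
        Complex.I • (SemiProd.J γ).baseChange ℂ ((vertical γ).baseChange ℂ (conjV X))))) := by
    intro X
    rw [complexMap_apply, conjE_apply]
    dsimp only
    rw [map_neg, conjD_baseChange]
    simp only [map_add, map_neg, map_smulₛₗ, Complex.conj_I, baseChange_conjV, neg_smul, neg_neg,
      sub_eq_add_neg]
  -- The pairing is sesquilinear, so it is rewritten as a complex bilinear function of `Y` and `conj
  -- X`, which can be compared on real vectors.
  have h2 : sigma.compl₁₂ (complexMap γ ω) (LinearMap.prod
      ((horizontal γ).baseChange ℂ + Complex.I • (SemiProd.J γ).baseChange ℂ ∘ₗ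
        (horizontal γ).baseChange ℂ)
      (-((SemiProd.Ω₂ γ ω).baseChange ℂ ∘ₗ ((vertical γ).baseChange ℂ -
        Complex.I • (SemiProd.J γ).baseChange ℂ ∘ₗ (vertical γ).baseChange ℂ)))) =
      (-2 * Complex.I) • (SemiProd.Ω₁ γ ω).baseChange ℂ := by
    refine complexification_ext₂ fun a b => ?_
    rw [LinearMap.compl₁₂_apply, complexMap_tmul, sigma_apply]
    simp only [LinearMap.prod_apply, Function.prod, LinearMap.neg_apply, LinearMap.comp_apply,
      LinearMap.add_apply, LinearMap.sub_apply, LinearMap.smul_apply, LinearMap.baseChange_tmul,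
      TensorProduct.smul_tmul', smul_eq_mul, mul_one, map_add, map_sub,
      LinearMap.BilinForm.baseChange_tmul, Complex.real_smul, SemiProd.Ω₂_apply,
      SemiProd.Ω₁_apply, SemiProd.fst_J, SemiProd.snd_J, fst_horizontal, snd_horizontal,
      fst_vertical, snd_vertical, map_neg, map_zero, LinearMap.zero_apply]
    rw [← hω.isAlt.neg_eq (SemiProd.snd γ b)]
    push_cast
    ring
  rw [sigma_comm, h1]
  exact LinearMap.congr_fun₂ h2 Y (conjV X)

theorem complexMap_mem (hJ : IsComplexStructure (SemiProd.J γ))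
    (hΩ : IsSymplectic (SemiProd.Ω₂ γ ω)) (hΩ' : (SemiProd.Ω₁ γ ω).IsAlt)
    (X : ℂ ⊗[ℝ] SemiProd γ) : complexMap γ ω X ∈ (ofComplex (SemiProd.J γ) hJ).L := by
  rw [complexMap_apply]
  constructor
  · change _ ∈ T10 _
    rw [mem_T10, map_sub, map_smul, baseChange_sq hJ.1, smul_sub, smul_smul, Complex.I_mul_I]
    module
  · refine Submodule.neg_mem _ ?_
    rw [baseChange_mem_dualAnnihilator_iff hJ.1 hΩ hΩ' Ω₁_eq_Ω₂_J, map_add, map_smul,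
      baseChange_sq hJ.1, smul_add, smul_smul, Complex.I_mul_I]
    module

theorem complexMap_bijective [FiniteDimensional ℝ 𝔤] (hJ : IsComplexStructure (SemiProd.J γ))
    (hΩ : IsSymplectic (SemiProd.Ω₂ γ ω)) (hΩ' : (SemiProd.Ω₁ γ ω).IsAlt) :
    Function.Bijective ((complexMap γ ω).codRestrict _ (complexMap_mem hJ hΩ hΩ')) := by
  set p := (horizontal γ).baseChange ℂ with hp
  set q := (vertical γ).baseChange ℂ with hq
  set j := (SemiProd.J γ).baseChange ℂ with hj
  have hpp : ∀ X, p (p X) = p X := LinearMap.congr_fun (f := p ∘ₗ p) <|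
    complexification_ext fun x => rfl
  have hqq : ∀ X, q (q X) = q X := LinearMap.congr_fun (f := q ∘ₗ q) <|
    complexification_ext fun x => rfl
  have hpq : ∀ X, p (q X) = 0 := LinearMap.congr_fun (f := p ∘ₗ q) (g := 0) <|
    complexification_ext fun x => by
      have : horizontal γ (vertical γ x) = 0 := rfl
      simp [hp, hq, this]
  have hqp : ∀ X, q (p X) = 0 := LinearMap.congr_fun (f := q ∘ₗ p) (g := 0) <|
    complexification_ext fun x => by
      have : vertical γ (horizontal γ x) = 0 := rfl
      simp [hp, hq, this]
  have hadd : ∀ X, X = p X + q X := LinearMap.congr_fun (f := LinearMap.id) (g := p + q) <|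
    complexification_ext fun x => by
      have : horizontal γ x + vertical γ x = x := SemiProd.ext' (add_zero _) (zero_add _)
      simp [hp, hq, ← TensorProduct.tmul_add, this]
  have hpj : ∀ X, p (j X) = j (q X) := LinearMap.congr_fun (f := p ∘ₗ j) (g := j ∘ₗ q) <|
    complexification_ext fun x => by
      have : horizontal γ (SemiProd.J γ x) = SemiProd.J γ (vertical γ x) := rfl
      simp [hp, hq, hj, this]
  have hqj : ∀ X, q (j X) = j (p X) := LinearMap.congr_fun (f := q ∘ₗ j) (g := j ∘ₗ p) <|
    complexification_ext fun x => by
      have : vertical γ (SemiProd.J γ x) = SemiProd.J γ (horizontal γ x) :=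
        SemiProd.ext' neg_zero.symm rfl
      simp [hp, hq, hj, this]
  have hinj := baseChange_injective hΩ.nondegenerate
  constructor
  · rw [injective_iff_map_eq_zero]
    intro X hX
    have h := congrArg Subtype.val hX
    rw [LinearMap.codRestrict_apply, complexMap_apply] at h
    have h1 := congrArg p (congrArg Prod.fst h)
    have h2 : q X + Complex.I • j (q X) = 0 := hinj <| by
      have := congrArg Prod.snd h
      rw [map_zero]
      exact neg_eq_zero.1 this
    have h3 := congrArg q h2
    dsimp only at h1
    rw [map_sub, map_smul, ← hp, ← hj, hpp, hpj, hqp, map_zero, smul_zero, sub_zero] at h1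
    rw [map_add, map_smul, hqq, hqj, hpq, map_zero, smul_zero, add_zero, map_zero] at h3
    rw [hadd X, h3, add_zero]
    exact h1.trans (map_zero p)
  · rintro ⟨⟨Z, α⟩, hZ, hα⟩
    obtain ⟨W, rfl⟩ := (cxFlat hΩ.nondegenerate).surjective α
    have hZ' : j Z = Complex.I • Z := mem_T10.1 hZ
    have hW : j W = -(Complex.I • W) :=
      (baseChange_mem_dualAnnihilator_iff hJ.1 hΩ hΩ' Ω₁_eq_Ω₂_J W).1 hα
    -- A `(1,0)`-vector is determined by its horizontal part, `Z = pZ - iJ(pZ)`, and a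
    -- `(0,1)`-vector by its vertical part, `W = qW + iJ(qW)`. The sign of `qW` compensates the one
    -- in `complexMap`.
    refine ⟨p Z - q W, Subtype.ext ?_⟩
    have h1 : p (p Z - q W) = p Z := by rw [map_sub, hpp, hpq, sub_zero]
    have h2 : q (p Z - q W) = -q W := by rw [map_sub, hqp, hqq, zero_sub]
    rw [LinearMap.codRestrict_apply, complexMap_apply, ← hp, ← hq, ← hj, h1, h2, ← hqj, hZ',
      map_neg, ← hpj, hW]
    refine Prod.ext ?_ ?_
    · change p Z - Complex.I • q (Complex.I • Z) = Z
      conv_rhs => rw [hadd Z]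
      rw [map_smul, smul_smul, Complex.I_mul_I]
      module
    · change -((SemiProd.Ω₂ γ ω).baseChange ℂ _) = (SemiProd.Ω₂ γ ω).baseChange ℂ W
      rw [← map_neg]
      congr 1
      conv_rhs => rw [hadd W]
      rw [map_neg, map_smul, neg_neg, smul_smul, Complex.I_mul_I]
      module

end ComplexParametrization

end

end GenGeom

/-! ### The theorem. -/

open GenGeom in
theorem theorem5p6 {𝔤 : Type*} [LieRing 𝔤] [LieAlgebra ℝ 𝔤] [FiniteDimensional ℝ 𝔤]
    (ω : LinearMap.BilinForm ℝ 𝔤) (hω : IsSymplectic ω)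
    (g : LinearMap.BilinForm ℝ 𝔤) (hg : IsPseudoMetric g)
    (γ : FlatConnection 𝔤) (hγ_torsion : IsTorsionFree γ) (hγ_symp : IsSymplecticConnection γ ω) :
    ∃ (hJ : IsComplexStructure (SemiProd.J γ)) (hΩ₂ : IsSymplectic (SemiProd.Ω₂ γ ω)),
      IsSymplectic (SemiProd.Ω₁ γ ω) ∧ IsSymplectic (SemiProd.Ω₃ γ ω) ∧
      IsPseudoMetric (SemiProd.Δ γ g) ∧
      (IsPseudoKahler (SemiProd.J γ) (SemiProd.Δ γ g) →
        (∀ a b, invComp g hg.nondegenerate ω (γ a b) =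
          γ (invComp g hg.nondegenerate ω a) (invComp g hg.nondegenerate ω b)) →
        (∃ Λ ∈ ⋀[ℂ]^2 (ofComplex (SemiProd.J γ) hJ).L,
          (∀ t : ℝ, IsGenComplex ((ofComplex (SemiProd.J γ) hJ).deform ((t : ℂ) • Λ))) ∧
          (ofComplex (SemiProd.J γ) hJ).deform Λ =
            (ofSymplectic (SemiProd.Ω₂ γ ω) hΩ₂).L.map (bField (SemiProd.Ω₁ γ ω))) ∧
        Nonempty (GenComplex.DGAEquiv (ofComplex (SemiProd.J γ) hJ)
          (ofSymplectic (SemiProd.Ω₂ γ ω) hΩ₂))) := by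
  have hJ := isComplexStructure_J hγ_torsion
  have hΩ₁ := isSymplectic_Ω₁ hω hγ_torsion hγ_symp
  have hΩ₂ := isSymplectic_Ω₂ hω hγ_symp
  refine ⟨hJ, hΩ₂, hΩ₁, isSymplectic_Ω₃ hω hγ_symp, isPseudoMetric_Δ hg, fun hK hT =>
    ⟨exists_deform_eq hJ hΩ₂ hΩ₁ Ω₁_eq_Ω₂_J, ?_⟩⟩
  -- The splittings by `P` and `Q` provide the automorphisms `A` and `B` that carry the pairing `Ω₂`
  -- of `L_{Ω₂}` to the pairing `Ω₁` of `L_J`.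
  obtain ⟨P, Q, hP, hQ, h₁, h₂⟩ := exists_isSplitting hT
    (connection_sub_invComp_symm hω hg hγ_torsion hγ_symp hT hK.closed)
    (connection_invComp_sq hω hg hγ_symp hT) (skew_invComp hω.isAlt hg)
  exact nonempty_dgaEquiv_of_parametrization
    (LinearEquiv.ofBijective _ (complexMap_bijective hJ hΩ₂ hΩ₁.isAlt)) (symplecticEquiv hΩ₂)
    (fun X Y => Subtype.ext (complexMap_lie hγ_torsion hγ_symp X Y))
    (symplecticEquiv_lie hΩ₂)
    (fun X Y => sigma_complexMap X Y hω) (sigma_symplecticEquiv hΩ₂)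
    (LinearEquiv.ofBijective _ (splitMap_bijective hP.proj))
    (LinearEquiv.ofBijective _ (splitMap_bijective hQ.proj))
    (splitMap_lie hγ_torsion hP) (splitMap_lie hγ_torsion hQ) (Ω₂_splitMap h₁ h₂)
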